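/- Let $\Lambda=\mathbb Z[t^{\pm1}]$. **Medial quandles.** A medial quandle is a set $Q$ with a binary operation $\triangleright$ such that $x\triangleright x=x$, each map $x\mapsto x\triangleright y$ is a permutation of $Q$, and $(w\triangleright x)\triangleright(y\triangleright z)=(w\triangleright y)\triangleright(x\triangleright z)$. Let $M$ be a $\Lambda$-module, $N\subseteq M$ a submodule, $I$ a nonempty set, $(m_i)_{i\in I}$ elements of $M$ with all $m_i-m_j\in N$, and $(X_i)_{i\in I}$ submodules of $N$ with $(1-t)X_i=0$. Then $Q(N,(m_i),(X_i))$ is the disjoint union of the sets $Q_i=N/X_i$ with the medial quandle operation $x\triangleright y=m_j-m_i+tx+(1-t)y+X_i\in Q_i$ for $x\in Q_i$, $y\in Q_j$. **Invariants of a link.** Let $L=K_1\cup\dots\cup K_\mu$ ($\mu\ge1$) be an oriented classical or virtual link, and let $D$ be any diagram of $L$, with set of classical crossings $C(D)$ and set of arcs $A(D)$ (the components are cut at classical underpasses only; a component without classical underpasses is a single closed arc). For $a\in A(D)$ let $\kappa(a)=i$ if $a$ lies on $K_i$. At a classical crossing $c$ let $w(c)=\pm1$ be the writhe, $a(c)$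 the overpassing arc, and $b_1(c)$, $b_2(c)$ the underpassing arcs on the right and left side of $a(c)$, respectively; so the underpassing strand of $K_{\kappa(b_1(c))}$ runs from $b_1(c)$ to $b_2(c)$ if $w(c)=1$ and from $b_2(c)$ to $b_1(c)$ if $w(c)=-1$. * $\mathrm{MQ}(L)$ is the medial quandle generated by elements $q_a$, $a\in A(D)$, subject to the relations $q_{b_2(c)}=q_{b_1(c)}\triangleright q_{a(c)}$, $c\in C(D)$. * $M_A^{\mathrm{red}}(L)$ is the cokernel of the $\Lambda$-linear map $\varrho_D:\Lambda^{C(D)}\to\Lambda^{A(D)}$, $\varrho_D(c)=(1-t)a(c)+t\,b_1(c)-b_2(c)$, and $\varsigma_D:\Lambda^{A(D)}\to M_A^{\mathrm{red}}(L)$ is the canonical map. The map $\phi_L^{\mathrm{red}}:M_A^{\mathrm{red}}(L)\to\Lambda$ is the $\Lambda$-linear map with $\varsigma_D(a)\mapsto1$ for all $a\in A(D)$. * $A_\mu=\Lambda\oplus\mathbb Z^{\mu-1}$, where $t$ acts trivially on $\mathbb Z^{\mu-1}$, whose coordinates are indexed by $2,\dots,\mu$; $\phi_\tau:M_A^{\mathrm{red}}(L)\to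 A_\mu$ is the $\Lambda$-linear map with $\varsigma_D(a)\mapsto(1,0)$ if $\kappa(a)=1$ and $\varsigma_D(a)\mapsto(1,e_{\kappa(a)})$ if $\kappa(a)>1$. The set $M_i(L)$ of meridians of $K_i$ consists of all $x\in M_A^{\mathrm{red}}(L)$ with $\phi_\tau(x)=\phi_\tau(\varsigma_D(a))$ for some arc $a$ of $K_i$. * The longitude of $K_i$ is $$\chi_i(L)=\varsigma_D\Bigl(\sum_{\kappa(b_1(c))=i}w(c)a(c)-\tfrac12\sum_{\kappa(b_1(c))=i}w(c)\bigl(b_1(c)+b_2(c)\bigr)\Bigr),$$ where the second sum has even coefficients. It lies in $\ker\phi_L^{\mathrm{red}}$ and $(1-t)\chi_i(L)=0$. Let $X_i$ be the cyclic submodule of $\ker\phi_L^{\mathrm{red}}$ generated by $\chi_i(L)$. **Theorem.** 1. For every choice of meridians $m_i\in M_i(L)$, $1\le i\le\mu$, the quandle $Q(\ker\phi_L^{\mathrm{red}},m_1,\dots,m_\mu,X_1,\dots,X_\mu)$ is isomorphic to the medial quandle $\mathrm{MQ}(L)$. 2. Suppose that $D$ has alternating writhes, i.e. each arc is the underpassing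 arc of one classical crossing of writhe $1$ and one of writhe $-1$. Then each component $K_i$ has an arc that is oriented from a crossing of writhe $1$ to a crossing of writhe $-1$. For each $i$, let $b_{i0}$ be any such arc of $K_i$; walking along $K_i$ from $b_{i0}$, let $c_{ij}$ be the crossing at the end of $b_{ij}$, $a_{ij}$ its overpassing arc, and $b_{i(j+1)}$ the next arc of $K_i$. If $K_i$ has $2n_i$ arcs, put, for $0\le j<2n_i$, $$\xi_i(b_{ij})=\sum_{k=0}^{j-1}(-1)^{k+1}\varsigma_D(a_{ik})\ \ (j\text{ even}),\qquad \xi_i(b_{ij})=t^{-1}\varsigma_D(b_{i0})+t^{-1}\sum_{k=0}^{j-1}(-1)^{k+1}\varsigma_D(a_{ik})\ \ (j\text{ odd}),$$ which are elements of $\ker\phi_L^{\mathrm{red}}$. Let $Q_D=Q(\ker\phi_L^{\mathrm{red}},\varsigma_D(b_{10}),\dots,\varsigma_D(b_{\mu0}),X_1,\dots,X_\mu)$ and let $\xi:A(D)\to Q_D$ be given by $\xi(a)=\xi_i(a)+X_i\in Q_i$ for each arc $a$ of $K_i$. Then there is an isomorphism $q_\xi:\mathrm{MQ}(L)\to Q_D$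 with $q_\xi(q_a)=\xi(a)$ for all $a\in A(D)$. -/

import Mathlib

/-- A medial quandle: a set with a binary operation `▷` which is idempotent, whose right
translations `x ↦ x ▷ y` are permutations, and which satisfies the medial law. -/
class MedialQuandle (Q : Type*) where
  op : Q → Q → Q
  op_self : ∀ x, op x x = x
  op_bijective : ∀ y, Function.Bijective (fun x => op x y)
  medial : ∀ w x y z, op (op w x) (op y z) = op (op w y) (op x z)

infixl:65 " ▷ " => MedialQuandle.op

/-- An isomorphism of medial quandles: a bijection that respects `▷`. -/
structure MedialQuandleIso (P Q : Type*) [MedialQuandle P] [MedialQuandle Q] extends P ≃ Q where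
  map_op : ∀ x y : P, toFun (x ▷ y) = toFun x ▷ toFun y

namespace MedialQuandle

/-! ### Medial quandles given by generators and relations -/

/-- Formal expressions in generators `A`, the operation `▷` and the inverse operation `▷⁻¹`. -/
inductive Expr (A : Type*) where
  | gen : A → Expr A
  | op : Expr A → Expr A → Expr A
  | inv : Expr A → Expr A → Expr A

/-- The smallest congruence on formal expressions that contains the relations `R` and all
instances of the axioms of medial quandles. -/
inductive ExprRel {A : Type*} (R : Expr A → Expr A → Prop) : Expr A → Expr A → Prop where
  | of {x y} : R x y → ExprRel R x y
  | refl (x) : ExprRel R x x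
  | symm {x y} : ExprRel R x y → ExprRel R y x
  | trans {x y z} : ExprRel R x y → ExprRel R y z → ExprRel R x z
  | congr_op {x x' y y'} : ExprRel R x x' → ExprRel R y y' → ExprRel R (.op x y) (.op x' y')
  | congr_inv {x x' y y'} : ExprRel R x x' → ExprRel R y y' → ExprRel R (.inv x y) (.inv x' y')
  | op_self (x) : ExprRel R (.op x x) x
  | op_inv (x y) : ExprRel R (.op (.inv x y) y) x
  | inv_op (x y) : ExprRel R (.inv (.op x y) y) x
  | medial (w x y z) :
      ExprRel R (.op (.op w x) (.op y z)) (.op (.op w y) (.op x z))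

/-- The congruence as a setoid. -/
def exprSetoid {A : Type*} (R : Expr A → Expr A → Prop) : Setoid (Expr A) where
  r := ExprRel R
  iseqv := ⟨.refl, .symm, .trans⟩

/-- The medial quandle generated by `A` subject to the relations `R`. -/
def Presented {A : Type*} (R : Expr A → Expr A → Prop) : Type _ := Quotient (exprSetoid R)

/-- The element of a presented medial quandle represented by a generator. -/
def Presented.gen {A : Type*} (R : Expr A → Expr A → Prop) (a : A) : Presented R :=
  Quotient.mk (exprSetoid R) (.gen a)

instance {A : Type*} (R : Expr A → Expr A → Prop) : MedialQuandle (Presented R) where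
  op := Quotient.map₂ Expr.op fun _ _ h _ _ h' => ExprRel.congr_op h h'
  op_self := by
    rintro ⟨x⟩
    exact Quotient.sound (ExprRel.op_self x)
  op_bijective := by
    rintro ⟨y⟩
    refine Function.bijective_iff_has_inverse.mpr
      ⟨Quotient.map (fun x => Expr.inv x y) fun _ _ h => ExprRel.congr_inv h (.refl y), ?_, ?_⟩
    · rintro ⟨x⟩
      exact Quotient.sound (ExprRel.inv_op x y)
    · rintro ⟨x⟩
      exact Quotient.sound (ExprRel.op_inv x y)
  medial := by
    rintro ⟨w⟩ ⟨x⟩ ⟨y⟩ ⟨z⟩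
    exact Quotient.sound (ExprRel.medial w x y z)

end MedialQuandle

/-! ### The medial quandle built from a module -/

/-- The ring `ℤ[t, t⁻¹]`; its variable `t` is `LaurentPolynomial.T 1`. -/
abbrev Lambda : Type := LaurentPolynomial ℤ

/-- The variable `t` of `ℤ[t, t⁻¹]`. -/
noncomputable abbrev tVar : Lambda := LaurentPolynomial.T 1

/-- The inverse `t⁻¹` of the variable of `ℤ[t, t⁻¹]`. -/
noncomputable abbrev tInv : Lambda := LaurentPolynomial.T (-1)

/-- The homomorphism `ℤ[t, t⁻¹] → ℤ` with `t ↦ 1`. -/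
noncomputable def augmentation : Lambda →+* ℤ :=
  LaurentPolynomial.eval₂ (RingHom.id ℤ) 1

theorem eq_zero_of_two_zsmul {x : Lambda} (h : (2 : ℤ) • x = 0) : x = 0 := by
  rcases mul_eq_zero.mp ((zsmul_eq_mul x 2).symm.trans h) with h2 | h2
  · have h3 : augmentation 2 = 0 := by simpa using congrArg augmentation h2
    rw [map_ofNat] at h3
    norm_num at h3
  · exact h2

theorem tInv_smul_tVar_smul {M : Type*} [AddCommGroup M] [Module Lambda M] (x : M) :
    tInv • tVar • x = x := by
  rw [smul_smul, ← LaurentPolynomial.T_add]; simp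

theorem tVar_smul_tInv_smul {M : Type*} [AddCommGroup M] [Module Lambda M] (x : M) :
    tVar • tInv • x = x := by
  rw [smul_smul, ← LaurentPolynomial.T_add]; simp

/-- The data from which the quandle `Q(N, (m_i), (X_i))` is built: a submodule `N` of a
`Λ`-module `M`, elements `m_i` of `M` whose differences lie in `N`, and submodules `X_i` of `N`
annihilated by `1 - t`. -/
structure QuandleData (I M : Type*) [Nonempty I] [AddCommGroup M] [Module Lambda M] where
  N : Submodule Lambda M
  m : I → M
  m_sub_mem : ∀ i j, m i - m j ∈ N
  X : I → Submodule Lambda N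
  X_annihilated : ∀ i, ∀ x ∈ X i, (1 - tVar) • x = 0

namespace QuandleData

variable {I M : Type*} [Nonempty I] [AddCommGroup M] [Module Lambda M]

/-- The underlying set of `Q(N, (m_i), (X_i))`: the disjoint union of the quotients `N / X_i`. -/
def Carrier (d : QuandleData I M) : Type _ := Σ i : I, d.N ⧸ d.X i

/-- The difference `m_j - m_i` as an element of `N`. -/
def diff (d : QuandleData I M) (j i : I) : d.N := ⟨d.m j - d.m i, d.m_sub_mem j i⟩

/-- Multiplication by `1 - t`, as a well-defined map from `N / X_j` to `N`. -/
noncomputable def oneSubT (d : QuandleData I M) (j : I) : (d.N ⧸ d.X j) →ₗ[Lambda] d.N :=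
  (d.X j).liftQ (LinearMap.lsmul Lambda d.N (1 - tVar)) fun x hx => by
    exact d.X_annihilated j x hx

/-- For `x ∈ N / X_i` and `y ∈ N / X_j`, the element
`x ▷ y = m_j - m_i + t x + (1 - t) y + X_i` of `N / X_i`. -/
noncomputable def op (d : QuandleData I M) (x y : d.Carrier) : d.Carrier :=
  ⟨x.1, (d.X x.1).mkQ (d.diff y.1 x.1) + tVar • x.2 + (d.X x.1).mkQ (d.oneSubT y.1 y.2)⟩

theorem op_mk (d : QuandleData I M) (i j : I) (x y : d.N) :
    d.op ⟨i, (d.X i).mkQ x⟩ ⟨j, (d.X j).mkQ y⟩ =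
      ⟨i, (d.X i).mkQ (d.diff j i + tVar • x + (1 - tVar) • y)⟩ := by
  rfl

theorem exists_rep (d : QuandleData I M) (x : d.Carrier) :
    ∃ (i : I) (n : d.N), x = ⟨i, (d.X i).mkQ n⟩ := by
  obtain ⟨i, q⟩ := x
  obtain ⟨n, rfl⟩ := (d.X i).mkQ_surjective q
  exact ⟨i, n, rfl⟩

noncomputable instance (d : QuandleData I M) : MedialQuandle d.Carrier where
  op := d.op
  op_self x := by
    obtain ⟨i, n, rfl⟩ := d.exists_rep x
    rw [op_mk]
    congr 2
    have : d.diff i i = 0 := by ext; simp [diff]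
    rw [this]; module
  op_bijective y := by
    constructor
    · rintro ⟨i, x⟩ ⟨i', x'⟩ h
      obtain rfl : i = i' := congrArg Sigma.fst h
      have h2 := eq_of_heq (Sigma.mk.inj h).2
      simp only [add_left_inj, add_right_inj] at h2
      have h3 := congrArg (fun z => tInv • z) h2
      simp only [tInv_smul_tVar_smul] at h3
      rw [h3]
    · rintro ⟨i, x⟩
      refine ⟨⟨i, tInv • (x - (d.X i).mkQ (d.diff y.1 i)
        - (d.X i).mkQ (d.oneSubT y.1 y.2))⟩, ?_⟩
      simp only [op, tVar_smul_tInv_smul]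
      congr 1
      abel
  medial w x y z := by
    obtain ⟨h, w, rfl⟩ := d.exists_rep w
    obtain ⟨i, x, rfl⟩ := d.exists_rep x
    obtain ⟨j, y, rfl⟩ := d.exists_rep y
    obtain ⟨k, z, rfl⟩ := d.exists_rep z
    simp only [op_mk]
    congr 2
    ext
    simp only [diff, Submodule.coe_add, Submodule.coe_smul]
    module

end QuandleData

/-! ### Oriented virtual link diagrams -/

/-- The Gauss diagram of an oriented virtual link diagram with `μ` ordered components.
There are `n` classical crossings; each is passed once on the upper strand, the passage
`(c, true)`, and once on the lower strand, the passage `(c, false)`.  Walking along the oriented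
components, passage `p` is followed by passage `next p`; `comp p` is the component on which `p`
lies.  A component may have no passages at all.  The sign of a crossing is its writhe.
Classical link diagrams are the planar special case. -/
structure GaussDiagram (μ : ℕ) where
  n : ℕ
  next : Equiv.Perm (Fin n × Bool)
  comp : Fin n × Bool → Fin μ
  comp_eq_iff : ∀ p q, comp p = comp q ↔ next.SameCycle p q
  writhe : Fin n → ℤˣ

namespace GaussDiagram

variable {μ : ℕ} (D : GaussDiagram μ)

/-- The passage of crossing `c` on its upper strand. -/
abbrev overPass (c : Fin D.n) : Fin D.n × Bool := (c, true)

/-- The passage of crossing `c` on its lower strand. -/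
abbrev underPass (c : Fin D.n) : Fin D.n × Bool := (c, false)

/-- The pieces into which the passages cut the components: `inl p` is the piece from passage `p`
to passage `next p`, and `inr i` is the whole component `i`, if it has no passages. -/
abbrev Piece : Type := (Fin D.n × Bool) ⊕ {i : Fin μ // ∀ p, D.comp p ≠ i}

/-- The pieces that enter and leave the upper strand of a crossing are not separated. -/
inductive Joined : D.Piece → D.Piece → Prop where
  | mk (c : Fin D.n) : Joined (.inl (D.next.symm (D.overPass c))) (.inl (D.overPass c))

/-- The arcs of the diagram, obtained by cutting the components at underpasses only. -/
def Arc : Type := Quot D.Joined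

/-- The overpassing arc `a(c)`. -/
def overArc (c : Fin D.n) : D.Arc := Quot.mk _ (.inl (D.overPass c))

/-- The underpassing arc that is oriented away from the crossing `c`. -/
def outArc (c : Fin D.n) : D.Arc := Quot.mk _ (.inl (D.underPass c))

/-- The underpassing arc that is oriented toward the crossing `c`. -/
def inArc (c : Fin D.n) : D.Arc := Quot.mk _ (.inl (D.next.symm (D.underPass c)))

/-- The underpassing arc `b₁(c)` on the right side of the oriented arc `a(c)`: the lower strand
passes from right to left if the writhe is `1`, and from left to right if the writhe is `-1`. -/
def b₁ (c : Fin D.n) : D.Arc := if D.writhe c = 1 then D.inArc c else D.outArc c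

/-- The underpassing arc `b₂(c)` on the left side of the oriented arc `a(c)`. -/
def b₂ (c : Fin D.n) : D.Arc := if D.writhe c = 1 then D.outArc c else D.inArc c

theorem comp_symm (p : Fin D.n × Bool) : D.comp (D.next.symm p) = D.comp p :=
  (D.comp_eq_iff _ _).mpr ⟨1, by simp⟩

/-- The component on which an arc lies. -/
def kappa : D.Arc → Fin μ :=
  Quot.lift (Sum.elim D.comp Subtype.val) (by rintro _ _ ⟨c⟩; exact D.comp_symm _)

theorem kappa_inArc (c : Fin D.n) : D.kappa (D.inArc c) = D.comp (D.underPass c) := D.comp_symm _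

theorem kappa_outArc (c : Fin D.n) : D.kappa (D.outArc c) = D.comp (D.underPass c) := rfl

theorem kappa_b₁ (c : Fin D.n) : D.kappa (D.b₁ c) = D.comp (D.underPass c) := by
  unfold b₁; split
  · exact D.kappa_inArc c
  · exact D.kappa_outArc c

theorem kappa_b₂ (c : Fin D.n) : D.kappa (D.b₂ c) = D.comp (D.underPass c) := by
  unfold b₂; split
  · exact D.kappa_outArc c
  · exact D.kappa_inArc c

/-! ### The medial quandle of a link -/

/-- The relations `q_{b₂(c)} = q_{b₁(c)} ▷ q_{a(c)}`. -/
inductive CrossingRel : MedialQuandle.Expr D.Arc → MedialQuandle.Expr D.Arc → Prop where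
  | mk (c : Fin D.n) :
      CrossingRel (.gen (D.b₂ c)) (.op (.gen (D.b₁ c)) (.gen (D.overArc c)))

/-- The medial quandle generated by the arcs, with one relation for each classical crossing. -/
abbrev MQ : Type := MedialQuandle.Presented D.CrossingRel

/-- The generator `q_a`. -/
abbrev q (a : D.Arc) : D.MQ := MedialQuandle.Presented.gen D.CrossingRel a

/-! ### The reduced Alexander module -/

/-- The map of free modules `ϱ(c) = (1 - t) a(c) + t b₁(c) - b₂(c)`. -/
noncomputable def rho : (Fin D.n →₀ Lambda) →ₗ[Lambda] (D.Arc →₀ Lambda) :=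
  Finsupp.linearCombination Lambda fun c =>
    Finsupp.single (D.overArc c) (1 - tVar) + Finsupp.single (D.b₁ c) tVar
      - Finsupp.single (D.b₂ c) 1

/-- The reduced Alexander module, the cokernel of `ϱ`. -/
abbrev AlexanderModule : Type := (D.Arc →₀ Lambda) ⧸ LinearMap.range D.rho

/-- The canonical map `ς` onto the cokernel. -/
noncomputable abbrev sigma : (D.Arc →₀ Lambda) →ₗ[Lambda] D.AlexanderModule :=
  (LinearMap.range D.rho).mkQ

/-- The element of the reduced Alexander module represented by an arc. -/
noncomputable abbrev arcClass (a : D.Arc) : D.AlexanderModule := D.sigma (Finsupp.single a 1)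

/-- The map `φ^red` to `Λ` that sends every arc to `1`. -/
noncomputable def phiRed : D.AlexanderModule →ₗ[Lambda] Lambda :=
  (LinearMap.range D.rho).liftQ (Finsupp.linearCombination Lambda fun _ => 1) (by
    rintro _ ⟨x, rfl⟩
    rw [LinearMap.mem_ker, ← LinearMap.comp_apply]
    refine LinearMap.congr_fun (g := 0) (Finsupp.lhom_ext fun c r => ?_) x
    simp [rho])

theorem phiRed_arcClass (a : D.Arc) : D.phiRed (D.arcClass a) = 1 := by
  simp [phiRed]

/-! ### Longitudes -/

/-- The classical crossings at which the underpassing arcs belong to component `i`. -/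
def undercrossings (i : Fin μ) : Finset (Fin D.n) :=
  Finset.univ.filter fun c => D.kappa (D.b₁ c) = i

/-- Each arc is entered at underpasses as often as it is left at underpasses. -/
theorem sum_inArc {G : Type*} [AddCommGroup G] (i : Fin μ) (f : D.Arc → G) :
    ∑ c ∈ D.undercrossings i, f (D.inArc c) = ∑ c ∈ D.undercrossings i, f (D.outArc c) := by
  have h := Equiv.sum_comp D.next.symm
    (fun p => if D.comp p = i then f (Quot.mk _ (.inl p)) else 0)
  simp only [Fintype.sum_prod_type, Fintype.sum_bool, Finset.sum_add_distrib, comp_symm] at h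
  have h2 : ∀ c, (Quot.mk _ (.inl (D.next.symm (c, true))) : D.Arc) = Quot.mk _ (.inl (c, true)) :=
    fun c => Quot.sound ⟨c⟩
  simp only [h2, add_right_inj] at h
  simp only [undercrossings, kappa_b₁, Finset.sum_filter]
  exact h

theorem sum_writhe_smul {G : Type*} [AddCommGroup G] (i : Fin μ) (f : D.Arc → G) :
    ∑ c ∈ D.undercrossings i, (D.writhe c : ℤ) • (f (D.b₂ c) - f (D.b₁ c)) = 0 := by
  have h : ∀ c, (D.writhe c : ℤ) • (f (D.b₂ c) - f (D.b₁ c)) =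
      f (D.outArc c) - f (D.inArc c) := by
    intro c
    rcases Int.units_eq_one_or (D.writhe c) with h | h <;> simp [b₁, b₂, h]
  simp only [h, Finset.sum_sub_distrib, sum_inArc, sub_self]

/-- The chain `∑ w(c) (b₁(c) + b₂(c))`, over the crossings where component `i` passes under. -/
noncomputable def underSum (i : Fin μ) : D.Arc →₀ ℤ :=
  ∑ c ∈ D.undercrossings i,
    (D.writhe c : ℤ) • (Finsupp.single (D.b₁ c) 1 + Finsupp.single (D.b₂ c) 1)

/-- The chain `(1/2) ∑ w(c) (b₁(c) + b₂(c))`; its coefficients are integers. -/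
noncomputable def halfUnderSum (i : Fin μ) : D.Arc →₀ ℤ :=
  (D.underSum i).mapRange (fun k => k / 2) (by simp)

theorem two_smul_halfUnderSum (i : Fin μ) : (2 : ℤ) • D.halfUnderSum i = D.underSum i := by
  classical
  ext x
  simp only [halfUnderSum, Finsupp.smul_apply, Finsupp.mapRange_apply, smul_eq_mul]
  refine Int.mul_ediv_cancel' ?_
  have h := D.sum_writhe_smul i (fun a => Finsupp.single a (1 : ℤ) x)
  have h2 : D.underSum i x = D.underSum i x - ∑ c ∈ D.undercrossings i,
      (D.writhe c : ℤ) • (Finsupp.single (D.b₂ c) (1 : ℤ) x - Finsupp.single (D.b₁ c) (1 : ℤ) x) := by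
    rw [h, sub_zero]
  rw [h2, underSum, Finsupp.finsetSum_apply, ← Finset.sum_sub_distrib]
  refine Finset.dvd_sum fun c _ => ⟨(D.writhe c : ℤ) * Finsupp.single (D.b₁ c) (1 : ℤ) x, ?_⟩
  simp only [Finsupp.smul_apply, Finsupp.add_apply, smul_eq_mul]
  ring

/-- The chain `∑ w(c) a(c) - (1/2) ∑ w(c) (b₁(c) + b₂(c))`, where both sums are taken over the
crossings at which component `i` passes under. -/
noncomputable def longitudeChain (i : Fin μ) : D.Arc →₀ ℤ :=
  ∑ c ∈ D.undercrossings i, (D.writhe c : ℤ) • Finsupp.single (D.overArc c) 1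
    - D.halfUnderSum i

/-- The inclusion of the integral chains on arcs into the free `Λ`-module on the arcs. -/
noncomputable def toLambda : (D.Arc →₀ ℤ) →+ (D.Arc →₀ Lambda) :=
  Finsupp.mapRange.addMonoidHom (Int.castAddHom Lambda)

/-- The longitude `χ_i` of component `i` in the reduced Alexander module. -/
noncomputable def longitude (i : Fin μ) : D.AlexanderModule :=
  D.sigma (D.toLambda (D.longitudeChain i))

theorem two_smul_longitudeChain (i : Fin μ) :
    (2 : ℤ) • D.toLambda (D.longitudeChain i) = ∑ c ∈ D.undercrossings i, (D.writhe c : ℤ) •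
      ((2 : ℤ) • Finsupp.single (D.overArc c) (1 : Lambda) -
        (Finsupp.single (D.b₁ c) 1 + Finsupp.single (D.b₂ c) 1)) := by
  rw [← map_zsmul, longitudeChain, smul_sub, two_smul_halfUnderSum, underSum, Finset.smul_sum,
    ← Finset.sum_sub_distrib, map_sum]
  refine Finset.sum_congr rfl fun c _ => ?_
  simp only [map_sub, map_zsmul, map_add, smul_sub, smul_comm (2 : ℤ)]
  simp [toLambda]

theorem phiRed_longitude (i : Fin μ) : D.phiRed (D.longitude i) = 0 := by
  have h := congrArg (fun x => D.phiRed (D.sigma x)) (D.two_smul_longitudeChain i)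
  simp only [map_zsmul, map_sum, map_sub, map_add, phiRed_arcClass] at h
  apply eq_zero_of_two_zsmul
  · rw [longitude, h]
    refine Finset.sum_eq_zero fun c _ => ?_
    norm_num

theorem oneSubT_smul_longitude (i : Fin μ) : (1 - tVar) • D.longitude i = 0 := by
  rw [longitude, ← map_smul]
  refine (Submodule.Quotient.mk_eq_zero _).mpr ⟨∑ c ∈ D.undercrossings i,
    (D.writhe c : ℤ) • Finsupp.single c 1, ?_⟩
  have inj : ∀ x y : D.Arc →₀ Lambda, (2 : ℤ) • x = (2 : ℤ) • y → x = y := by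
    intro x y h
    ext1 a
    rw [← sub_eq_zero] at h ⊢
    refine eq_zero_of_two_zsmul ?_
    have h2 := DFunLike.congr_fun h a
    rw [zsmul_sub]
    exact h2
  apply inj
  rw [smul_comm, two_smul_longitudeChain, ← sub_eq_zero]
  have h := D.sum_writhe_smul i fun a => (1 + tVar) • Finsupp.single a (1 : Lambda)
  rw [← neg_eq_zero, ← Finset.sum_neg_distrib] at h
  rw [← h, map_sum, Finset.smul_sum, Finset.smul_sum, ← Finset.sum_sub_distrib]
  refine Finset.sum_congr rfl fun c _ => ?_
  have e : ∀ (a : D.Arc) (r : Lambda), Finsupp.single a r = r • Finsupp.single a 1 := by simp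
  simp only [map_zsmul, rho, Finsupp.linearCombination_single, one_smul]
  rw [e _ (1 - tVar), e _ tVar]
  module

/-- The kernel of `φ^red`. -/
noncomputable abbrev kerPhi : Submodule Lambda D.AlexanderModule := LinearMap.ker D.phiRed

/-- The cyclic submodule of `ker φ^red` generated by the longitude of component `i`. -/
noncomputable def longitudeSubmodule (i : Fin μ) : Submodule Lambda D.kerPhi :=
  Submodule.span Lambda {⟨D.longitude i, D.phiRed_longitude i⟩}

/-- The group `ℤ`, as a `Λ`-module on which `t` acts trivially. -/
def TrivialInt : Type := ℤ

instance : AddCommGroup TrivialInt := inferInstanceAs (AddCommGroup ℤ)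

noncomputable instance : Module Lambda TrivialInt :=
  letI : Module ℤ TrivialInt := inferInstanceAs (Module ℤ ℤ)
  Module.compHom TrivialInt augmentation

/-- The generator of `TrivialInt`. -/
def TrivialInt.one : TrivialInt := (1 : ℤ)

theorem tVar_smul_trivialInt (n : TrivialInt) : tVar • n = n := by
  change augmentation tVar • (n : ℤ) = n
  simp [augmentation]

/-- The module `A_μ = Λ ⊕ ℤ^(μ-1)`; the coordinates after the first one are indexed by
the components other than the first one. -/
abbrev AMu (μ : ℕ) [NeZero μ] : Type := Lambda × ({i : Fin μ // i ≠ 0} → TrivialInt)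

section

variable [NeZero μ]

/-- The image in `A_μ` of an arc of component `i`. -/
noncomputable def AMu.basePoint (i : Fin μ) : AMu μ :=
  (1, fun j => if i = j.1 then TrivialInt.one else 0)

/-- The map `φ_τ` from the reduced Alexander module to `A_μ`. -/
noncomputable def phiTau : D.AlexanderModule →ₗ[Lambda] AMu μ :=
  (LinearMap.range D.rho).liftQ
    (Finsupp.linearCombination Lambda fun a => AMu.basePoint (D.kappa a)) (by
    rintro _ ⟨x, rfl⟩
    rw [LinearMap.mem_ker, ← LinearMap.comp_apply]
    refine LinearMap.congr_fun (g := 0) (Finsupp.lhom_ext fun c r => ?_) x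
    have h : ∀ j, (AMu.basePoint j : AMu μ) = (1, (AMu.basePoint j : AMu μ).2) := fun _ => rfl
    have h2 : ∀ v : {i : Fin μ // i ≠ 0} → TrivialInt, tVar • v = v :=
      fun v => funext fun j => tVar_smul_trivialInt (v j)
    simp only [rho, LinearMap.comp_apply, Finsupp.linearCombination_single, map_smul, map_sub,
      map_add, kappa_b₁, kappa_b₂, LinearMap.zero_apply]
    rw [h (D.kappa _), h (D.comp _)]
    ext j
    · simp
    · simp [sub_smul, h2])

theorem phiTau_arcClass (a : D.Arc) : D.phiTau (D.arcClass a) = AMu.basePoint (D.kappa a) := by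
  simp [phiTau]

theorem phiTau_fst (x : D.AlexanderModule) : (D.phiTau x).1 = D.phiRed x := by
  obtain ⟨x, rfl⟩ := (LinearMap.range D.rho).mkQ_surjective x
  refine LinearMap.congr_fun (f := (LinearMap.fst Lambda Lambda _ ∘ₗ D.phiTau) ∘ₗ D.sigma)
    (g := D.phiRed ∘ₗ D.sigma) (Finsupp.lhom_ext fun a r => ?_) x
  simp [phiTau, phiRed, AMu.basePoint]

/-! ### Meridians -/

/-- The set of meridians of component `i` in the reduced Alexander module. -/
def meridians (i : Fin μ) : Set D.AlexanderModule :=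
  {x | ∃ a : D.Arc, D.kappa a = i ∧ D.phiTau x = D.phiTau (D.arcClass a)}

theorem phiRed_of_mem_meridians {i : Fin μ} {x : D.AlexanderModule} (hx : x ∈ D.meridians i) :
    D.phiRed x = 1 := by
  obtain ⟨a, -, h⟩ := hx
  rw [← phiTau_fst, h, phiTau_fst, phiRed_arcClass]

theorem arcClass_mem_meridians (a : D.Arc) : D.arcClass a ∈ D.meridians (D.kappa a) :=
  ⟨a, rfl, rfl⟩

/-- The quandle `Q(ker φ^red, m_1, …, m_μ, X_1, …, X_μ)`, where `m_i` is a meridian of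
component `i` and `X_i` is generated by the longitude of component `i`. -/
noncomputable def quandleData (m : Fin μ → D.AlexanderModule) (hm : ∀ i, m i ∈ D.meridians i) :
    QuandleData (Fin μ) D.AlexanderModule where
  N := D.kerPhi
  m := m
  m_sub_mem i j := by
    simp [D.phiRed_of_mem_meridians (hm i), D.phiRed_of_mem_meridians (hm j)]
  X := D.longitudeSubmodule
  X_annihilated i x hx := by
    obtain ⟨r, rfl⟩ := Submodule.mem_span_singleton.mp hx
    rw [smul_comm]
    ext1
    simp [D.oneSubT_smul_longitude i]

end

/-! ### Diagrams with alternating writhes -/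

/-- Each arc is the underpassing arc of one classical crossing of writhe `1` and of one
classical crossing of writhe `-1`. -/
def AlternatingWrithes : Prop :=
  ∀ a : D.Arc, (∃! c, D.writhe c = 1 ∧ (D.b₁ c = a ∨ D.b₂ c = a)) ∧
    (∃! c, D.writhe c = -1 ∧ (D.b₁ c = a ∨ D.b₂ c = a))

theorem exists_next_under (c : Fin D.n) :
    ∃ k : ℕ, ((D.next ^ (k + 1)) (D.underPass c)).2 = false := by
  refine ⟨orderOf D.next - 1, ?_⟩
  rw [Nat.sub_add_cancel (orderOf_pos D.next), pow_orderOf_eq_one]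
  rfl

/-- The crossing of the first underpass that one meets when walking along the component from
the underpass of `c`, i.e. the crossing at the end of the arc that starts at `c`. -/
def nextUnder (c : Fin D.n) : Fin D.n :=
  ((D.next ^ (Nat.find (D.exists_next_under c) + 1)) (D.underPass c)).1

theorem inArc_nextUnder (c : Fin D.n) : D.inArc (D.nextUnder c) = D.outArc c := by
  have key : ∀ j ≤ Nat.find (D.exists_next_under c),
      (Quot.mk D.Joined (.inl ((D.next ^ j) (D.underPass c))) : D.Arc) = D.outArc c := by
    intro j hj
    induction j with
    | zero => rfl
    | succ j ih =>
      rw [← ih (Nat.le_of_succ_le hj)]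
      have h := Nat.find_min (D.exists_next_under c) hj
      have h1 : (D.next ^ (j + 1)) (D.underPass c) =
          D.overPass ((D.next ^ (j + 1)) (D.underPass c)).1 := Prod.ext rfl (by simpa using h)
      have h2 : (D.next ^ j) (D.underPass c) =
          D.next.symm ((D.next ^ (j + 1)) (D.underPass c)) := by
        rw [pow_succ', Equiv.Perm.mul_apply, Equiv.symm_apply_apply]
      rw [h2, h1]
      exact (Quot.sound ⟨_⟩).symm
  rw [← key _ le_rfl]
  have h := Nat.find_spec (D.exists_next_under c)
  have h1 : D.underPass (D.nextUnder c) =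
      (D.next ^ (Nat.find (D.exists_next_under c) + 1)) (D.underPass c) := Prod.ext rfl h.symm
  unfold inArc
  rw [h1, pow_succ', Equiv.Perm.mul_apply, Equiv.symm_apply_apply]

/-- For each component `i`, the underpass of the crossing `s i` lies on component `i`, and the
arc that starts there is oriented from a crossing of writhe `1` to a crossing of writhe `-1`. -/
def IsBase (s : Fin μ → Fin D.n) : Prop :=
  ∀ i, D.kappa (D.outArc (s i)) = i ∧ D.writhe (s i) = 1 ∧ D.writhe (D.nextUnder (s i)) = -1

variable (s : Fin μ → Fin D.n)

/-- The arc `b_{ij}`: the `j`-th arc on the walk along component `i` from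
`b_{i0}`, the arc that starts at `s i`. -/
def walkArc (i : Fin μ) (j : ℕ) : D.Arc := D.outArc (D.nextUnder^[j] (s i))

/-- The crossing `c_{ij}` at the end of the arc `b_{ij}`. -/
def walkCrossing (i : Fin μ) (j : ℕ) : Fin D.n := D.nextUnder^[j + 1] (s i)

/-- The overpassing arc `a_{ij}` of the crossing `c_{ij}`. -/
def walkOverArc (i : Fin μ) (j : ℕ) : D.Arc := D.overArc (D.walkCrossing s i j)

/-- The alternating sum `∑_{k<j} (-1)^(k+1) ς(a_{ik})`. -/
noncomputable def walkSum (i : Fin μ) (j : ℕ) : D.AlexanderModule :=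
  ∑ k ∈ Finset.range j, (-1 : ℤ) ^ (k + 1) • D.arcClass (D.walkOverArc s i k)

/-- The value of `ξ_i` at `b_{ij}`, as an element of the reduced Alexander module. -/
noncomputable def xiValue (i : Fin μ) (j : ℕ) : D.AlexanderModule :=
  if Even j then D.walkSum s i j
  else tInv • D.arcClass (D.walkArc s i 0) + tInv • D.walkSum s i j

theorem phiRed_walkSum (i : Fin μ) (j : ℕ) :
    D.phiRed (D.walkSum s i j) = if Even j then 0 else -1 := by
  simp only [walkSum, map_sum, map_zsmul, phiRed_arcClass]
  induction j with
  | zero => simp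
  | succ j ih =>
    rw [Finset.sum_range_succ, ih]
    by_cases h : Even j
    · simp [h, Nat.even_add_one, h.add_one.neg_one_pow]
    · simp [h, Nat.even_add_one, (Nat.not_even_iff_odd.mp h).add_one.neg_one_pow]

theorem xiValue_mem (i : Fin μ) (j : ℕ) : D.xiValue s i j ∈ D.kerPhi := by
  rw [LinearMap.mem_ker, xiValue]
  split_ifs with h
  · rw [phiRed_walkSum, if_pos h]
  · simp only [map_add, map_smul, phiRed_arcClass, phiRed_walkSum, if_neg h]
    simp

/-- The index of an arc `a` of component `i`: the number `j < 2 n_i` with `a = b_{ij}`, where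
`2 n_i` is the number of arcs of component `i`. -/
noncomputable def walkIndex (a : D.Arc) : ℕ := sInf {j | D.walkArc s (D.kappa a) j = a}

section

variable [NeZero μ]

theorem walkArc_mem_meridians {s : Fin μ → Fin D.n} (hs : D.IsBase s) (i : Fin μ) :
    D.arcClass (D.walkArc s i 0) ∈ D.meridians i :=
  ⟨_, (hs i).1, rfl⟩

/-- The quandle `Q_D`, built from the meridians `ς(b_{i0})`. -/
noncomputable abbrev baseQuandleData {s : Fin μ → Fin D.n} (hs : D.IsBase s) :
    QuandleData (Fin μ) D.AlexanderModule :=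
  D.quandleData (fun i => D.arcClass (D.walkArc s i 0)) (D.walkArc_mem_meridians hs)

/-- The map `ξ` from the arcs to `Q_D`: an arc `a = b_{ij}` of component `i` is mapped to
`ξ_i(b_{ij}) + X_i`. -/
noncomputable def xi {s : Fin μ → Fin D.n} (hs : D.IsBase s) (a : D.Arc) :
    (D.baseQuandleData hs).Carrier :=
  ⟨D.kappa a, (D.longitudeSubmodule (D.kappa a)).mkQ
    ⟨D.xiValue s (D.kappa a) (D.walkIndex s a), D.xiValue_mem s (D.kappa a) (D.walkIndex s a)⟩⟩

end

end GaussDiagram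

-- The displacements `β_y β_x⁻¹` of a medial quandle, where `β_y` is `x ↦ x ▷ y`, generate an
-- abelian group, and conjugation by one `β_o` makes this group a `Λ`-module `V`. With `d x = β_x
-- β_o⁻¹`, the operation is recovered from the action: `x ▷ y = (d y - d x) +ᵥ x`, and `d (v +ᵥ x) =
-- d x + (1 - t) v`. These two identities are all that `Displacement` records; `Q(N, (m_i), (X_i))`
-- satisfies them too, with `N` acting by translation.
--
-- Write the longitude as the sum of the steps `w(c) (a(c) - b₁(c))` over the underpasses of `K_i`
-- (`longitude_eq_sum_step`). At an underpass of either sign, the class of the outgoing arc is that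
-- of the incoming arc plus `(1 - t)` times the step. Suppose first that each meridian is the class
-- of an arc `e_i`. Modulo `X_i` the steps sum to zero around `K_i`, so they have a primitive `H_i`
-- on the arcs of `K_i` with `H_i(e_i) = 0`, and `q_a ↦ H_i(a)` respects the crossing relations.
-- This gives `f : MQ(L) → Q`.
--
-- Conversely, `a ↦ d(q_a)` extends to a linear map `Ψ` from the Alexander module to `V`, and `x ∈
-- Q_i` is sent by `g` to `Ψ(x) +ᵥ q_{e_i}`. This is well defined because walking once around `K_i`
-- shows that the longitude fixes `q_{e_i}` (`vadd_q_of_mem`). On generators `g ∘ f` is the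
-- identity. For `f ∘ g`, the displacements `Ψ(x)` and `x` correspond under `f`: this holds for
-- differences of arcs, and corresponding pairs form a submodule (`matched`).
--
-- Two meridians of `K_i` differ by an element of `ker φ_τ`, which lies in `(1 - t) ker φ^red`
-- (`exists_eq_oneSubT_smul`); such a change is absorbed by translating each `Q_i`. In the
-- alternating case the formulas for `ξ_i` satisfy the recursion that defines `H_i`
-- (`xiValue_succ`), so `f` itself is the required map.

universe u

/-! ### Modules over `ℤ[t, t⁻¹]` -/

/-- An automorphism of an abelian group makes it a `ℤ[t, t⁻¹]`-module. -/
theorem exists_lambda_module {A : Type*} [AddCommGroup A] (θ : A ≃+ A) :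
    ∃ _ : Module Lambda A, ∀ x : A, tVar • x = θ x := by
  let u : (AddMonoid.End A)ˣ :=
    ⟨θ.toAddMonoidHom, θ.symm.toAddMonoidHom, by ext x; exact θ.apply_symm_apply x,
      by ext x; exact θ.symm_apply_apply x⟩
  -- `Λ` is the group ring of `ℤ`, so a unit of the endomorphism ring determines a ring homomorphism
  -- from `Λ`.
  let F : Lambda →ₐ[ℤ] AddMonoid.End A :=
    AddMonoidAlgebra.lift ℤ (AddMonoid.End A) ℤ ((Units.coeHom _).comp (zpowersHom _ u))
  refine ⟨Module.compHom A F.toRingHom, fun x => ?_⟩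
  have h : F tVar = θ.toAddMonoidHom := by
    change F (AddMonoidAlgebra.single 1 1) = _
    rw [AddMonoidAlgebra.lift_single]
    simp only [one_smul, MonoidHom.comp_apply, zpowersHom_apply, toAdd_ofAdd, zpow_one]
    rfl
  change F tVar x = θ x
  rw [h]
  rfl

/-- A set that is closed under addition, negation and multiplication by `t` and `t⁻¹` is closed
under scalar multiplication. -/
theorem smul_mem_of_tVar {M : Type*} [AddCommGroup M] [Module Lambda M] (S : AddSubgroup M)
    (h1 : ∀ x ∈ S, tVar • x ∈ S) (h2 : ∀ x ∈ S, tInv • x ∈ S) (r : Lambda) {x : M} (hx : x ∈ S) :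
    r • x ∈ S := by
  induction r using LaurentPolynomial.induction_on with
  | h_C a =>
    have : (LaurentPolynomial.C a : Lambda) • x = a • x := by
      rw [← Int.cast_smul_eq_zsmul Lambda]; simp
    rw [this]
    exact S.zsmul_mem hx a
  | h_add hp hq => rw [add_smul]; exact S.add_mem hp hq
  | h_C_mul_T n a h =>
    rw [add_comm (n : ℤ), LaurentPolynomial.T_add, mul_left_comm, mul_smul]
    exact h1 _ h
  | h_C_mul_T_Z n a h =>
    rw [sub_eq_neg_add, LaurentPolynomial.T_add, mul_left_comm, mul_smul]
    exact h2 _ h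

/-- Modulo `(1 - t) N`, a scalar acts through its augmentation. -/
theorem exists_smul_sub_augmentation (r : Lambda) :
    ∃ s : Lambda, r = (augmentation r : Lambda) + (1 - tVar) * s := by
  induction r using LaurentPolynomial.induction_on' with
  | add p q hp hq =>
    obtain ⟨a, ha⟩ := hp
    obtain ⟨b, hb⟩ := hq
    refine ⟨a + b, ?_⟩
    rw [map_add, Int.cast_add]
    linear_combination ha + hb
  | C_mul_T n a =>
    have key : ∀ n : ℤ, (1 - tVar) ∣ (LaurentPolynomial.T n - 1 : Lambda) := by
      intro n
      induction n with
      | zero => simp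
      | succ n ih =>
        obtain ⟨s, hs⟩ := ih
        refine ⟨s * tVar - 1, ?_⟩
        rw [LaurentPolynomial.T_add]
        linear_combination hs * tVar
      | pred n ih =>
        obtain ⟨s, hs⟩ := ih
        refine ⟨tInv * s + tInv, ?_⟩
        have h : (tVar * tInv : Lambda) = 1 := by rw [← LaurentPolynomial.T_add]; simp
        rw [sub_eq_add_neg (-(n : ℤ)), LaurentPolynomial.T_add]
        linear_combination hs * tInv + h
    obtain ⟨s, hs⟩ := key n
    refine ⟨LaurentPolynomial.C a * s, ?_⟩
    have h : augmentation (LaurentPolynomial.C a * LaurentPolynomial.T n) = a := by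
      simp [augmentation]
    have h2 : ((a : ℤ) : Lambda) = LaurentPolynomial.C a := by simp
    rw [h, h2]
    linear_combination LaurentPolynomial.C a * hs

/-! ### Displacements of medial quandles -/

namespace MedialQuandle

/-- The displacements of a medial quandle `P` form a `Λ`-module `V` acting on `P`, where
`d y - d x` is the displacement `β_y β_x⁻¹`. -/
structure Displacement (V P : Type*) [AddCommGroup V] [Module Lambda V] [AddAction V P]
    [MedialQuandle P] where
  d : P → V
  op_eq : ∀ x y : P, x ▷ y = (d y - d x) +ᵥ x
  d_vadd : ∀ (v : V) (x : P), d (v +ᵥ x) = d x + (1 - tVar) • v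

/-! ### The displacement group of a medial quandle -/

section

variable {P : Type*} [MedialQuandle P]

theorem op_right_distrib (x y z : P) : (x ▷ y) ▷ z = (x ▷ z) ▷ (y ▷ z) := by
  conv_lhs => rw [← op_self z]
  exact medial _ _ _ _

/-- The right translation `x ↦ x ▷ y`. -/
noncomputable def rightPerm (y : P) : Equiv.Perm P := Equiv.ofBijective _ (op_bijective y)

@[simp] theorem rightPerm_apply (x y : P) : rightPerm y x = x ▷ y := rfl

theorem rightPerm_map (g : Equiv.Perm P) (hg : ∀ x y, g (x ▷ y) = g x ▷ g y) (y : P) :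
    rightPerm (g y) = g * rightPerm y * g⁻¹ := by
  rw [eq_mul_inv_iff_mul_eq]
  ext x
  simp [hg]

theorem rightPerm_op (x y : P) : rightPerm (x ▷ y) = rightPerm y * rightPerm x * (rightPerm y)⁻¹ :=
  rightPerm_map (rightPerm y) (fun _ _ => op_right_distrib _ _ _) x

/-- The medial law says `β_{x ▷ o} β_y = β_{y ▷ o} β_x`. Since `β_{x ▷ o} = β_o β_x β_o⁻¹`,
cancelling `β_o` on the left gives commutativity. -/
theorem rightPerm_mul_comm (o x y : P) :
    rightPerm x * (rightPerm o)⁻¹ * (rightPerm y * (rightPerm o)⁻¹) =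
      rightPerm y * (rightPerm o)⁻¹ * (rightPerm x * (rightPerm o)⁻¹) := by
  have h : rightPerm (x ▷ o) * rightPerm y = rightPerm (y ▷ o) * rightPerm x := by
    ext w
    exact medial w y x o
  rw [rightPerm_op, rightPerm_op] at h
  have h2 : rightPerm x * (rightPerm o)⁻¹ * rightPerm y =
      rightPerm y * (rightPerm o)⁻¹ * rightPerm x := by
    apply mul_left_cancel (a := rightPerm o)
    simpa only [mul_assoc] using h
  rw [← mul_assoc, ← mul_assoc, h2]

/-- The group generated by the displacements `β_x β_o⁻¹`. -/
noncomputable def displacementGroup (o : P) : Subgroup (Equiv.Perm P) :=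
  Subgroup.closure (Set.range fun x => rightPerm x * (rightPerm o)⁻¹)

theorem displacementGroup_map_op (o : P) (g : Equiv.Perm P) (hg : g ∈ displacementGroup o)
    (x y : P) : g (x ▷ y) = g x ▷ g y := by
  have hβ : ∀ z x y : P, (rightPerm z)⁻¹ (x ▷ y) = (rightPerm z)⁻¹ x ▷ (rightPerm z)⁻¹ y := by
    intro z x y
    rw [Equiv.Perm.inv_eq_iff_eq, rightPerm_apply, op_right_distrib, ← rightPerm_apply _ z,
      ← rightPerm_apply _ z, ← Equiv.Perm.mul_apply, ← Equiv.Perm.mul_apply, mul_inv_cancel]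
    rfl
  induction hg using Subgroup.closure_induction generalizing x y with
  | mem g h =>
    obtain ⟨z, rfl⟩ := h
    simp only [Equiv.Perm.mul_apply, hβ, rightPerm_apply]
    exact op_right_distrib _ _ _
  | one => rfl
  | mul g h _ _ ihg ihh => simp only [Equiv.Perm.mul_apply, ihg, ihh]
  | inv g _ ih =>
    rw [Equiv.Perm.inv_eq_iff_eq, ih, ← Equiv.Perm.mul_apply, ← Equiv.Perm.mul_apply,
      mul_inv_cancel]
    rfl

/-- Conjugation by `β_o` sends the generator of `x` to that of `x ▷ o`, and `x ▷ o` runs through all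
of `P`. Hence conjugation is an automorphism of the group, which will serve as multiplication by
`t`. -/
theorem displacementGroup_map_conj (o : P) :
    (displacementGroup o).map (MulAut.conj (rightPerm o)).toMonoidHom = displacementGroup o := by
  rw [displacementGroup, MonoidHom.map_closure, ← Set.range_comp]
  congr 1
  rw [← (rightPerm o).surjective.range_comp (fun x => rightPerm x * (rightPerm o)⁻¹)]
  congr 1
  funext x
  simp [rightPerm_op, mul_assoc]

end

theorem exists_displacement {P : Type u} [MedialQuandle P] (o : P) :
    ∃ (V : Type u) (_ : AddCommGroup V) (_ : Module Lambda V) (_ : AddAction V P),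
      Nonempty (Displacement V P) := by
  have hcomm : IsMulCommutative (displacementGroup o) := by
    apply Subgroup.isMulCommutative_closure
    rintro _ ⟨x, rfl⟩ _ ⟨y, rfl⟩
    exact rightPerm_mul_comm o x y
  let _ : CommGroup (displacementGroup o) :=
    { (inferInstance : Group (displacementGroup o)) with mul_comm := hcomm.is_comm.comm }
  let θ : displacementGroup o ≃* displacementGroup o :=
    ((MulAut.conj (rightPerm o)).subgroupMap (displacementGroup o)).trans
      (MulEquiv.subgroupCongr (displacementGroup_map_conj o))
  obtain ⟨hM, ht⟩ := exists_lambda_module θ.toAdditive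
  have hd (x : P) : rightPerm x * (rightPerm o)⁻¹ ∈ displacementGroup o :=
    Subgroup.subset_closure ⟨x, rfl⟩
  refine ⟨Additive (displacementGroup o), inferInstance, hM, inferInstance,
    ⟨fun x => Additive.ofMul ⟨_, hd x⟩, ?_, ?_⟩⟩
  · intro x y
    change _ = (rightPerm y * (rightPerm o)⁻¹ * (rightPerm x * (rightPerm o)⁻¹)⁻¹) x
    have h : (rightPerm x).symm x = x := by
      rw [Equiv.symm_apply_eq, rightPerm_apply, op_self]
    simp [h]
  · intro v x
    rw [sub_smul, one_smul, ht, ← add_sub_assoc, add_comm]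
    -- In multiplicative notation: `v` is a quandle automorphism, so `β_{v x} = v β_x v⁻¹`, and `-t
    -- v` is the inverse of `β_o v β_o⁻¹`.
    apply Additive.toMul.injective
    apply Subtype.ext
    change rightPerm ((v.toMul : Equiv.Perm P) x) * (rightPerm o)⁻¹ =
      (v.toMul : Equiv.Perm P) * (rightPerm x * (rightPerm o)⁻¹) *
        (rightPerm o * (v.toMul : Equiv.Perm P) * (rightPerm o)⁻¹)⁻¹
    rw [rightPerm_map _ (displacementGroup_map_op o _ v.toMul.2)]
    group

/-! ### Displacements and homomorphisms -/

namespace Displacement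

variable {V P : Type*} [AddCommGroup V] [Module Lambda V] [AddAction V P] [MedialQuandle P]

theorem vadd_op (E : Displacement V P) (v : V) (x o : P) : (v +ᵥ x) ▷ o = (tVar • v) +ᵥ (x ▷ o) := by
  rw [E.op_eq, E.op_eq, E.d_vadd, vadd_vadd, vadd_vadd]
  congr 1
  module

theorem d_op (E : Displacement V P) (x y : P) : E.d (x ▷ y) = (1 - tVar) • E.d y + tVar • E.d x := by
  rw [E.op_eq, E.d_vadd]
  module

end Displacement

/-- The pairs of displacements that correspond to each other under a homomorphism. -/
def matched {V P W Q : Type*} [AddCommGroup V] [Module Lambda V] [AddAction V P]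
    [MedialQuandle P] [AddCommGroup W] [Module Lambda W] [AddAction W Q] [MedialQuandle Q]
    (E : Displacement V P) (F : Displacement W Q) (o : P) (f : P → Q)
    (hf : ∀ x y, f (x ▷ y) = f x ▷ f y) : Submodule Lambda (V × W) :=
  let S : AddSubgroup (V × W) :=
    { carrier := {v | ∀ p, f (v.1 +ᵥ p) = v.2 +ᵥ f p}
      zero_mem' := fun p => by simp
      add_mem' := fun {a b} ha hb p => by
        simp only [Set.mem_ofPred_eq] at ha hb
        rw [Prod.fst_add, Prod.snd_add, add_vadd, add_vadd, ha, hb]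
      neg_mem' := fun {a} ha p => by
        simp only [Set.mem_ofPred_eq] at ha
        rw [Prod.fst_neg, Prod.snd_neg, eq_neg_vadd_iff, ← ha, vadd_neg_vadd] }
  { S with
    smul_mem' := fun r x hx => by
      refine smul_mem_of_tVar S (fun v hv p => ?_) (fun v hv p => ?_) r hx
      -- The action of `t v` is known at points of the form `p ▷ o`, by `vadd_op`, and every point
      -- has this form. For `t⁻¹` the equation is checked after applying the injective map `▷ f o`.
      · obtain ⟨p, rfl⟩ := (op_bijective o).2 p
        simp only [Prod.smul_fst, Prod.smul_snd]
        rw [← E.vadd_op, hf, hf, hv, F.vadd_op]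
      · apply (op_bijective (f o)).1
        simp only [Prod.smul_fst, Prod.smul_snd]
        rw [← hf, E.vadd_op, F.vadd_op, tVar_smul_tInv_smul, tVar_smul_tInv_smul, hv, hf] }

theorem mem_matched {V P W Q : Type*} [AddCommGroup V] [Module Lambda V] [AddAction V P]
    [MedialQuandle P] [AddCommGroup W] [Module Lambda W] [AddAction W Q] [MedialQuandle Q]
    {E : Displacement V P} {F : Displacement W Q} {o : P} {f : P → Q}
    {hf : ∀ x y, f (x ▷ y) = f x ▷ f y} {v : V × W} :
    v ∈ matched E F o f hf ↔ ∀ p, f (v.1 +ᵥ p) = v.2 +ᵥ f p := Iff.rfl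

/-- The displacement `d x - d y` carries `p ▷ y` to `p ▷ x`, a description that every homomorphism
preserves. -/
theorem sub_mem_matched {V P W Q : Type*} [AddCommGroup V] [Module Lambda V] [AddAction V P]
    [MedialQuandle P] [AddCommGroup W] [Module Lambda W] [AddAction W Q] [MedialQuandle Q]
    (E : Displacement V P) (F : Displacement W Q) (o : P) (f : P → Q)
    (hf : ∀ x y, f (x ▷ y) = f x ▷ f y) (x y : P) :
    (E.d x - E.d y, F.d (f x) - F.d (f y)) ∈ matched E F o f hf := by
  intro p
  obtain ⟨p, rfl⟩ := (op_bijective y).2 p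
  have h1 : (E.d x - E.d y) +ᵥ (p ▷ y) = p ▷ x := by
    rw [E.op_eq, E.op_eq, vadd_vadd]
    congr 1
    abel
  have h2 : (F.d (f x) - F.d (f y)) +ᵥ (f p ▷ f y) = f p ▷ f x := by
    rw [F.op_eq, F.op_eq, vadd_vadd]
    congr 1
    abel
  simp only [h1, hf, h2]

/-! ### The universal property of a presentation -/

section

variable {A Q : Type*} [MedialQuandle Q]

/-- The value of an expression, when the generators have given values. -/
noncomputable def Expr.eval (ξ : A → Q) : Expr A → Q
  | .gen a => ξ a
  | .op x y => x.eval ξ ▷ y.eval ξ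
  | .inv x y => (rightPerm (y.eval ξ)).symm (x.eval ξ)

theorem ExprRel.eval_eq {R : Expr A → Expr A → Prop} {ξ : A → Q}
    (hξ : ∀ x y, R x y → x.eval ξ = y.eval ξ) {x y : Expr A} (h : ExprRel R x y) :
    x.eval ξ = y.eval ξ := by
  induction h with
  | of h => exact hξ _ _ h
  | refl => rfl
  | symm _ ih => exact ih.symm
  | trans _ _ ih1 ih2 => exact ih1.trans ih2
  | congr_op _ _ ih1 ih2 => simp only [Expr.eval, ih1, ih2]
  | congr_inv _ _ ih1 ih2 => simp only [Expr.eval, ih1, ih2]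
  | op_self x => exact MedialQuandle.op_self _
  | op_inv x y => exact (rightPerm (y.eval ξ)).apply_symm_apply _
  | inv_op x y => exact (rightPerm (y.eval ξ)).symm_apply_apply _
  | medial w x y z => exact MedialQuandle.medial _ _ _ _

theorem Presented.exists_lift {R : Expr A → Expr A → Prop} (ξ : A → Q)
    (hξ : ∀ x y, R x y → x.eval ξ = y.eval ξ) :
    ∃ f : Presented R → Q, (∀ x y, f (x ▷ y) = f x ▷ f y) ∧ ∀ a, f (.gen R a) = ξ a := by
  refine ⟨Quotient.lift (Expr.eval ξ) fun _ _ h => ExprRel.eval_eq hξ h, ?_, fun a => rfl⟩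
  rintro ⟨x⟩ ⟨y⟩
  rfl

theorem Presented.hom_ext {R : Expr A → Expr A → Prop} {f g : Presented R → Q}
    (hf : ∀ x y, f (x ▷ y) = f x ▷ f y) (hg : ∀ x y, g (x ▷ y) = g x ▷ g y)
    (h : ∀ a, f (.gen R a) = g (.gen R a)) : f = g := by
  funext x
  obtain ⟨x, rfl⟩ := Quotient.exists_rep x
  let cl : Expr A → Presented R := Quotient.mk (exprSetoid R)
  change f (cl x) = g (cl x)
  induction x with
  | gen a => exact h a
  | op x y ihx ihy =>
    change f (cl x ▷ cl y) = g (cl x ▷ cl y)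
    rw [hf, hg, ihx, ihy]
  | inv x y ihx ihy =>
    -- A homomorphism is only assumed to respect `▷`; the inverse operation is recovered by
    -- cancelling a right translation.
    apply (op_bijective (f (cl y))).1
    have e : cl (.inv x y) ▷ cl y = cl x :=
      Quotient.sound (s := exprSetoid R) (ExprRel.op_inv x y)
    change f (cl (.inv x y)) ▷ f (cl y) = g (cl (.inv x y)) ▷ f (cl y)
    rw [← hf, e, ihy, ← hg, e, ihx]

end

end MedialQuandle

/-! ### Displacements of `Q(N, (m_i), (X_i))` -/

namespace QuandleData

variable {I M : Type*} [Nonempty I] [AddCommGroup M] [Module Lambda M]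

noncomputable instance (d : QuandleData I M) : AddAction d.N d.Carrier where
  vadd n x := ⟨x.1, (d.X x.1).mkQ n + x.2⟩
  zero_vadd x := by
    change (⟨x.1, (d.X x.1).mkQ 0 + x.2⟩ : d.Carrier) = x
    rw [map_zero, zero_add]
    rfl
  add_vadd m n x := by
    change (⟨x.1, (d.X x.1).mkQ (m + n) + x.2⟩ : d.Carrier) =
      ⟨x.1, (d.X x.1).mkQ m + ((d.X x.1).mkQ n + x.2)⟩
    rw [map_add, add_assoc]

/-- The element of `Q_i` given by an element of `N / X_i`. -/
def pt (d : QuandleData I M) (i : I) (x : d.N ⧸ d.X i) : d.Carrier := ⟨i, x⟩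

theorem exists_pt (d : QuandleData I M) (x : d.Carrier) :
    ∃ (i : I) (n : d.N), x = d.pt i ((d.X i).mkQ n) := d.exists_rep x

theorem vadd_pt (d : QuandleData I M) (n : d.N) (i : I) (x : d.N ⧸ d.X i) :
    n +ᵥ d.pt i x = d.pt i ((d.X i).mkQ n + x) := rfl

theorem pt_op_pt (d : QuandleData I M) (i j : I) (x y : d.N) :
    d.pt i ((d.X i).mkQ x) ▷ d.pt j ((d.X j).mkQ y) =
      d.pt i ((d.X i).mkQ (d.diff j i + tVar • x + (1 - tVar) • y)) := rfl

/-- The element `m_i - m_o + (1 - t) x` of `N`, for `x ∈ Q_i`. -/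
noncomputable def displ (d : QuandleData I M) (o : I) (x : d.Carrier) : d.N :=
  d.diff x.1 o + d.oneSubT x.1 x.2

theorem displ_pt (d : QuandleData I M) (o i : I) (x : d.N) :
    d.displ o (d.pt i ((d.X i).mkQ x)) = d.diff i o + (1 - tVar) • x := rfl

/-- The displacement structure of `Q(N, (m_i), (X_i))`. -/
noncomputable def displacement (d : QuandleData I M) (o : I) :
    MedialQuandle.Displacement d.N d.Carrier where
  d := d.displ o
  op_eq x y := by
    obtain ⟨i, x, rfl⟩ := d.exists_pt x
    obtain ⟨j, y, rfl⟩ := d.exists_pt y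
    rw [pt_op_pt, vadd_pt, ← map_add, displ_pt, displ_pt]
    congr 2
    ext
    simp only [diff, Submodule.coe_add, Submodule.coe_sub, Submodule.coe_smul]
    module
  d_vadd n x := by
    obtain ⟨i, x, rfl⟩ := d.exists_pt x
    rw [vadd_pt, ← map_add, displ_pt, displ_pt]
    module

end QuandleData

/-! ### Sums along the cycles of a permutation -/

section Cycle

variable {α : Type*} (σ : Equiv.Perm α) (p : α)

/-- The sum of the values of `δ` on the first `n` steps of the walk from `p`. -/
def cycleSum {G : Type*} [AddCommGroup G] (δ : α → G) (n : ℕ) : G :=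
  ∑ k ∈ Finset.range n, δ (σ^[k + 1] p)

variable {G : Type*} [AddCommGroup G] (δ : α → G)

theorem exists_iterate_eq [Finite α] {q : α} (h : σ.SameCycle p q) : ∃ n : ℕ, σ^[n] p = q := by
  obtain ⟨n, hn⟩ := h.exists_nat_pow_eq
  exact ⟨n, by rwa [Equiv.Perm.iterate_eq_pow]⟩

theorem sameCycle_iterate (n : ℕ) : σ.SameCycle p (σ^[n] p) :=
  ⟨n, by rw [zpow_natCast, Equiv.Perm.iterate_eq_pow]⟩

theorem cycleSum_minimalPeriod [Fintype α] (hδ : ∀ q, ¬ σ.SameCycle p q → δ q = 0) :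
    cycleSum σ p δ (Function.minimalPeriod σ p) = ∑ q, δ q := by
  classical
  have hper : 0 < Function.minimalPeriod σ p :=
    Function.minimalPeriod_pos_of_mem_periodicPts (σ.injective.mem_periodicPts p)
  -- `cycleSum` samples the steps `1, …, n`; over a full period this is a rotation of the sum over
  -- `0, …, n - 1`.
  have h1 : cycleSum σ p δ (Function.minimalPeriod σ p) =
      ∑ k ∈ Finset.range (Function.minimalPeriod σ p), δ (σ^[k] p) := by
    have h := Finset.sum_range_succ' (fun k => δ (σ^[k] p)) (Function.minimalPeriod σ p)
    rw [Finset.sum_range_succ, Function.iterate_minimalPeriod] at h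
    exact (add_right_cancel h).symm
  have hinj : Set.InjOn (fun k => σ^[k] p) (Finset.range (Function.minimalPeriod σ p)) := by
    rw [Finset.coe_range]
    exact Function.iterate_injOn_Iio_minimalPeriod
  rw [h1, ← Finset.sum_image (f := δ) hinj]
  refine Finset.sum_subset (Finset.subset_univ _) fun q _ hq => hδ q fun hs => hq ?_
  obtain ⟨n, rfl⟩ := exists_iterate_eq σ p hs
  exact Finset.mem_image.mpr ⟨n % Function.minimalPeriod σ p,
    Finset.mem_range.mpr (Nat.mod_lt _ hper), Function.iterate_mod_minimalPeriod_eq⟩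

/-- A full period contributes the total `0`, so the partial sums depend on the number of steps only
modulo the period. -/
theorem cycleSum_congr [Fintype α] (hδ : ∀ q, ¬ σ.SameCycle p q → δ q = 0) (h0 : ∑ q, δ q = 0)
    {a b : ℕ} (h : σ^[a] p = σ^[b] p) : cycleSum σ p δ a = cycleSum σ p δ b := by
  have hper : Function.Periodic (cycleSum σ p δ) (Function.minimalPeriod σ p) := by
    intro n
    have h1 : cycleSum σ p δ (Function.minimalPeriod σ p + n) =
        cycleSum σ p δ (Function.minimalPeriod σ p) + cycleSum σ p δ n := by
      rw [cycleSum, Finset.sum_range_add]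
      refine congrArg₂ _ rfl (Finset.sum_congr rfl fun k _ => ?_)
      rw [add_assoc, add_comm, Function.iterate_add_apply, Function.iterate_minimalPeriod]
    rw [add_comm, h1, cycleSum_minimalPeriod σ p δ hδ, h0, zero_add]
  have hpos : 0 < Function.minimalPeriod σ p :=
    Function.minimalPeriod_pos_of_mem_periodicPts (σ.injective.mem_periodicPts p)
  rw [← hper.map_mod_nat a, ← hper.map_mod_nat b]
  congr 1
  rw [← Function.iterate_eq_iterate_iff_of_lt_minimalPeriod (f := σ) (x := p)
    (Nat.mod_lt _ hpos) (Nat.mod_lt _ hpos), Function.iterate_mod_minimalPeriod_eq,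
    Function.iterate_mod_minimalPeriod_eq, h]

/-- A function with total `0` on a cycle is the difference of a function on the cycle. -/
theorem exists_cycle_primitive [Fintype α] (hδ : ∀ q, ¬ σ.SameCycle p q → δ q = 0)
    (h0 : ∑ q, δ q = 0) : ∃ η : α → G, η p = 0 ∧ ∀ q, η (σ q) = η q + δ (σ q) := by
  classical
  -- The partial sum up to the first visit of `q`; by `cycleSum_congr` any other visit gives the
  -- same value. Off the cycle the value is `0`, consistently with `δ = 0` there.
  let η : α → G := fun q => if h : ∃ n : ℕ, σ^[n] p = q then cycleSum σ p δ (Nat.find h) else 0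
  have hη : ∀ n, η (σ^[n] p) = cycleSum σ p δ n := by
    intro n
    have h : ∃ m : ℕ, σ^[m] p = σ^[n] p := ⟨n, rfl⟩
    simp only [η, dif_pos h]
    exact cycleSum_congr σ p δ hδ h0 (Nat.find_spec h)
  refine ⟨η, ?_, fun q => ?_⟩
  · simpa [cycleSum] using hη 0
  · by_cases h : σ.SameCycle p q
    · obtain ⟨n, rfl⟩ := exists_iterate_eq σ p h
      rw [← Function.iterate_succ_apply' (⇑σ), hη, hη]
      exact Finset.sum_range_succ _ _
    · have h2 : ¬ σ.SameCycle p (σ q) := fun h2 => h (Equiv.Perm.sameCycle_apply_right.mp h2)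
      have hz : ∀ r, ¬ σ.SameCycle p r → η r = 0 := fun r hr => dif_neg fun ⟨n, hn⟩ =>
        hr (hn ▸ sameCycle_iterate σ p n)
      rw [hz _ h, hz _ h2, hδ _ h2, add_zero]

/-- One turn around the cycle returns to `u p`, and on the way it accumulates all values of `δ`. -/
theorem sum_vadd_eq_of_cycle [Fintype α] {P : Type*} [AddAction G P]
    (hδ : ∀ q, ¬ σ.SameCycle p q → δ q = 0) (u : α → P)
    (hu : ∀ q, σ.SameCycle p q → u (σ q) = δ (σ q) +ᵥ u q) : (∑ q, δ q) +ᵥ u p = u p := by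
  have h : ∀ n, u (σ^[n] p) = cycleSum σ p δ n +ᵥ u p := by
    intro n
    induction n with
    | zero => simp [cycleSum]
    | succ n ih =>
      rw [Function.iterate_succ_apply', hu _ (sameCycle_iterate σ p n), ih, vadd_vadd, cycleSum,
        cycleSum, Finset.sum_range_succ, add_comm, Function.iterate_succ_apply']
  rw [← cycleSum_minimalPeriod σ p δ hδ, ← h, Function.iterate_minimalPeriod]

end Cycle

namespace GaussDiagram

variable {μ : ℕ} (D : GaussDiagram μ)

/-! ### Walks along the components -/

theorem mem_undercrossings {i : Fin μ} {c : Fin D.n} :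
    c ∈ D.undercrossings i ↔ D.comp (D.underPass c) = i := by
  simp [undercrossings, kappa_b₁]

/-- The arc that contains the piece after a passage. -/
def arcAfter (p : Fin D.n × Bool) : D.Arc := Quot.mk _ (.inl p)

theorem arcAfter_over (p : Fin D.n × Bool) (h : (D.next p).2 = true) :
    D.arcAfter (D.next p) = D.arcAfter p := by
  have h1 : D.next p = D.overPass (D.next p).1 := Prod.ext rfl h
  have h2 : p = D.next.symm (D.overPass (D.next p).1) := by rw [← h1, Equiv.symm_apply_apply]
  conv_rhs => rw [h2]
  conv_lhs => rw [h1]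
  exact (Quot.sound ⟨_⟩).symm

theorem arcAfter_under (p : Fin D.n × Bool) (h : (D.next p).2 = false) :
    D.arcAfter (D.next p) = D.outArc (D.next p).1 ∧ D.arcAfter p = D.inArc (D.next p).1 := by
  have h1 : D.next p = D.underPass (D.next p).1 := Prod.ext rfl h
  have h2 : p = D.next.symm (D.underPass (D.next p).1) := by rw [← h1, Equiv.symm_apply_apply]
  constructor
  · conv_lhs => rw [h1]
    rfl
  · conv_lhs => rw [h2]
    rfl

/-- A component without passages is a single arc and has no underpasses, so statements about walks
are trivial on it. Every other arc contains the piece after some passage. -/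
theorem arc_cases (a : D.Arc) :
    (∃ p, a = D.arcAfter p) ∨ (D.undercrossings (D.kappa a) = ∅ ∧
      ∀ b, D.kappa b = D.kappa a → b = a) := by
  obtain ⟨p | j, rfl⟩ := Quot.exists_rep a
  · exact .inl ⟨p, rfl⟩
  · refine .inr ⟨Finset.eq_empty_of_forall_notMem fun c hc =>
      j.2 _ (D.mem_undercrossings.mp hc), fun b hb => ?_⟩
    obtain ⟨p | k, rfl⟩ := Quot.exists_rep b
    · exact absurd hb (j.2 p)
    · rw [Subtype.ext (show k.1 = j.1 from hb)]

theorem sameCycle_of_kappa_eq {p : Fin D.n × Bool} {a : D.Arc}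
    (h : D.kappa a = D.kappa (D.arcAfter p)) : ∃ q, D.next.SameCycle p q ∧ a = D.arcAfter q := by
  obtain ⟨q | j, rfl⟩ := Quot.exists_rep a
  · exact ⟨q, (D.comp_eq_iff _ _).mp h.symm, rfl⟩
  · exact absurd h.symm (j.2 p)

/-- Forward steps suffice: the passages of a component form a finite cycle, and the arc changes only
at underpasses. -/
theorem arc_induction {C : D.Arc → Prop} {e : D.Arc} (he : C e)
    (h : ∀ c ∈ D.undercrossings (D.kappa e), C (D.inArc c) → C (D.outArc c)) {a : D.Arc}
    (ha : D.kappa a = D.kappa e) : C a := by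
  rcases D.arc_cases e with ⟨p, rfl⟩ | ⟨-, h2⟩
  · obtain ⟨q, hq, rfl⟩ := D.sameCycle_of_kappa_eq ha
    obtain ⟨n, rfl⟩ := exists_iterate_eq D.next p hq
    clear ha hq
    induction n with
    | zero => exact he
    | succ n ih =>
      rw [Function.iterate_succ_apply']
      rcases hb : (D.next (D.next^[n] p)).2 with _ | _
      · obtain ⟨h1, h2⟩ := D.arcAfter_under _ hb
        rw [h1]
        refine h _ (D.mem_undercrossings.mpr ?_) (h2 ▸ ih)
        change D.comp _ = D.comp p
        rw [eq_comm, D.comp_eq_iff]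
        have h1 : D.underPass (D.next (D.next^[n] p)).1 = D.next^[n + 1] p := by
          rw [Function.iterate_succ_apply']
          exact Prod.ext rfl hb.symm
        rw [h1]
        exact sameCycle_iterate _ _ _
      · rwa [D.arcAfter_over _ hb]
  · rwa [h2 a ha]

/-- The function on passages with values `δ c` at the underpasses on component `i`. -/
def stepAt {G : Type*} [AddCommGroup G] (δ : Fin D.n → G) (i : Fin μ) (q : Fin D.n × Bool) : G :=
  if q.2 = false ∧ D.comp q = i then δ q.1 else 0

theorem sum_stepAt {G : Type*} [AddCommGroup G] (δ : Fin D.n → G) (i : Fin μ) :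
    ∑ q, D.stepAt δ i q = ∑ c ∈ D.undercrossings i, δ c := by
  simp only [Fintype.sum_prod_type, Fintype.sum_bool, stepAt, undercrossings, kappa_b₁,
    Finset.sum_filter]
  simp

theorem stepAt_eq_zero {G : Type*} [AddCommGroup G] (δ : Fin D.n → G) (p : Fin D.n × Bool)
    (q : Fin D.n × Bool) (h : ¬ D.next.SameCycle p q) :
    D.stepAt δ (D.kappa (D.arcAfter p)) q = 0 :=
  if_neg fun h2 => h ((D.comp_eq_iff _ _).mp h2.2.symm)

theorem exists_arc_primitive {G : Type*} [AddCommGroup G] (δ : Fin D.n → G) (e : D.Arc)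
    (h0 : ∑ c ∈ D.undercrossings (D.kappa e), δ c = 0) :
    ∃ H : D.Arc → G, H e = 0 ∧
      ∀ c ∈ D.undercrossings (D.kappa e), H (D.outArc c) = H (D.inArc c) + δ c := by
  rcases D.arc_cases e with ⟨p, rfl⟩ | ⟨h1, -⟩
  · rw [← D.sum_stepAt] at h0
    obtain ⟨η, h1, h2⟩ := exists_cycle_primitive D.next p _ (D.stepAt_eq_zero δ p) h0
    -- The primitive on passages descends to arcs because the increment at an overpass is `0`.
    refine ⟨Quot.lift (Sum.elim η fun _ => 0) ?_, h1, fun c hc => ?_⟩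
    · rintro _ _ ⟨c⟩
      have h := h2 (D.next.symm (D.overPass c))
      rw [Equiv.apply_symm_apply] at h
      simp [h, stepAt]
    · have h := h2 (D.next.symm (D.underPass c))
      rw [Equiv.apply_symm_apply, stepAt, if_pos ⟨rfl, D.mem_undercrossings.mp hc⟩] at h
      exact h
  · exact ⟨0, rfl, by simp [h1]⟩

theorem sum_vadd_eq_of_arc {G P : Type*} [AddCommGroup G] [AddAction G P] (δ : Fin D.n → G)
    (a : D.Arc) (u : D.Arc → P)
    (hu : ∀ c ∈ D.undercrossings (D.kappa a), u (D.outArc c) = δ c +ᵥ u (D.inArc c)) :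
    (∑ c ∈ D.undercrossings (D.kappa a), δ c) +ᵥ u a = u a := by
  rcases D.arc_cases a with ⟨p, rfl⟩ | ⟨h1, -⟩
  · rw [← D.sum_stepAt]
    refine sum_vadd_eq_of_cycle D.next p _ (D.stepAt_eq_zero δ p) (fun q => u (D.arcAfter q))
      fun q hq => ?_
    rcases hb : (D.next q).2 with _ | _
    · obtain ⟨h1, h2⟩ := D.arcAfter_under _ hb
      have h3 : D.next q = D.underPass (D.next q).1 := Prod.ext rfl hb
      have h4 : D.comp (D.next q) = D.kappa (D.arcAfter p) :=
        ((D.comp_eq_iff _ _).mpr (Equiv.Perm.sameCycle_apply_right.mpr hq)).symm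
      simp only [h1, h2, stepAt, if_pos (And.intro hb h4)]
      exact hu _ (D.mem_undercrossings.mpr (h3 ▸ h4))
    · simp [D.arcAfter_over _ hb, stepAt, hb]
  · simp [h1]

/-! ### Longitudes as sums of steps -/

/-- The chain `w(c) (a(c) - b₁(c))`. -/
noncomputable def step (c : Fin D.n) : D.AlexanderModule :=
  (D.writhe c : ℤ) • (D.arcClass (D.overArc c) - D.arcClass (D.b₁ c))

theorem longitude_eq_sum_step (i : Fin μ) :
    D.longitude i = ∑ c ∈ D.undercrossings i, D.step c := by
  have inj : ∀ x y : D.Arc →₀ Lambda, (2 : ℤ) • x = (2 : ℤ) • y → x = y := by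
    intro x y h
    ext1 a
    rw [← sub_eq_zero] at h ⊢
    refine eq_zero_of_two_zsmul ?_
    have h2 := DFunLike.congr_fun h a
    rw [zsmul_sub]
    exact h2
  have key : D.toLambda (D.longitudeChain i) = ∑ c ∈ D.undercrossings i,
      (D.writhe c : ℤ) • (Finsupp.single (D.overArc c) (1 : Lambda) -
        Finsupp.single (D.b₁ c) 1) := by
    -- Doubling removes the halved sum. The two doubled chains then differ by `∑ w(c) (b₂(c) -
    -- b₁(c))`, which cancels along the component.
    apply inj
    rw [two_smul_longitudeChain, ← sub_eq_zero, Finset.smul_sum, ← Finset.sum_sub_distrib]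
    have h := D.sum_writhe_smul i fun a => Finsupp.single a (1 : Lambda)
    rw [← neg_eq_zero, ← Finset.sum_neg_distrib] at h
    rw [← h]
    refine Finset.sum_congr rfl fun c _ => ?_
    module
  rw [longitude, key, map_sum]
  simp only [map_zsmul, map_sub, step]

theorem crossing_relation (c : Fin D.n) :
    D.arcClass (D.b₂ c) =
      (1 - tVar) • D.arcClass (D.overArc c) + tVar • D.arcClass (D.b₁ c) := by
  have h : D.sigma (D.rho (Finsupp.single c 1)) = 0 :=
    (Submodule.Quotient.mk_eq_zero _).mpr ⟨_, rfl⟩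
  have hr : D.rho (Finsupp.single c 1) = (1 - tVar) • Finsupp.single (D.overArc c) 1 +
      tVar • Finsupp.single (D.b₁ c) 1 - Finsupp.single (D.b₂ c) 1 := by
    simp [rho]
  rw [hr, map_sub, map_add, sub_eq_zero, map_smul, map_smul] at h
  exact h.symm

theorem phiRed_step (c : Fin D.n) : D.phiRed (D.step c) = 0 := by
  rw [step, map_zsmul, map_sub, phiRed_arcClass, phiRed_arcClass, sub_self, smul_zero]

/-- The crossing relation, written in the direction of the walk. Both signs of the writhe give the
same formula, since exchanging `b₁` and `b₂` is compensated by the sign in the step. -/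
theorem arcClass_outArc (c : Fin D.n) :
    D.arcClass (D.outArc c) = D.arcClass (D.inArc c) + (1 - tVar) • D.step c := by
  have h := D.crossing_relation c
  rcases Int.units_eq_one_or (D.writhe c) with hw | hw
  · simp only [b₁, b₂, if_pos hw] at h
    rw [step, hw, h, b₁, if_pos hw]
    simp only [Units.val_one]
    module
  · have hw' : ¬ D.writhe c = 1 := by rw [hw]; decide
    simp only [b₁, b₂, if_neg hw'] at h
    rw [step, hw, h, b₁, if_neg hw']
    simp only [Units.val_neg, Units.val_one]
    module

end GaussDiagram

/-! ### The isomorphism for meridians represented by arcs -/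

namespace GaussDiagram

open MedialQuandle

variable {μ : ℕ} (D : GaussDiagram μ)

/-- The chain `w(c) (a(c) - b₁(c))` as an element of the kernel of `φ^red`. -/
noncomputable def stepKer (c : Fin D.n) : D.kerPhi := ⟨D.step c, D.phiRed_step c⟩

theorem sum_stepKer_mem (i : Fin μ) :
    ∑ c ∈ D.undercrossings i, D.stepKer c ∈ D.longitudeSubmodule i := by
  have h : ∑ c ∈ D.undercrossings i, D.stepKer c = ⟨D.longitude i, D.phiRed_longitude i⟩ := by
    apply Subtype.ext
    refine Eq.trans ?_ (D.longitude_eq_sum_step i).symm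
    exact AddSubmonoidClass.coe_finsetSum _ _
  rw [h]
  exact Submodule.mem_span_singleton_self _

/-- Since `1 - t` kills the longitude, its cyclic submodule consists of integer multiples. This is
needed because a stabilizer in `V` is a priori only a subgroup. -/
theorem smul_longitude (i : Fin μ) (r : Lambda) :
    r • D.longitude i = augmentation r • D.longitude i := by
  obtain ⟨s, hs⟩ := exists_smul_sub_augmentation r
  conv_lhs => rw [hs]
  rw [add_smul, mul_comm, mul_smul, D.oneSubT_smul_longitude, smul_zero, add_zero,
    Int.cast_smul_eq_zsmul]

/-- The linear map to a module of displacements of `MQ(L)` that extends `a ↦ d (q_a)`. -/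
theorem exists_displacement_map {V : Type*} [AddCommGroup V] [Module Lambda V] [AddAction V D.MQ]
    (E : Displacement V D.MQ) :
    ∃ Ψ : D.AlexanderModule →ₗ[Lambda] V, ∀ a, Ψ (D.arcClass a) = E.d (D.q a) := by
  refine ⟨(LinearMap.range D.rho).liftQ
    (Finsupp.linearCombination Lambda fun a => E.d (D.q a)) ?_, fun a => ?_⟩
  · rintro _ ⟨x, rfl⟩
    rw [LinearMap.mem_ker, ← LinearMap.comp_apply]
    refine LinearMap.congr_fun (g := 0) (Finsupp.lhom_ext fun c r => ?_) x
    have h : D.q (D.b₂ c) = D.q (D.b₁ c) ▷ D.q (D.overArc c) :=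
      Quotient.sound (s := exprSetoid D.CrossingRel) (ExprRel.of ⟨c⟩)
    have h2 := E.d_op (D.q (D.b₁ c)) (D.q (D.overArc c))
    rw [← h] at h2
    simp only [rho, LinearMap.comp_apply, Finsupp.linearCombination_single, map_smul, map_sub,
      map_add, LinearMap.zero_apply]
    rw [h2]
    module
  · simp

/-- The counterpart of `arcClass_outArc` in `MQ(L)`: passing an underpass of either sign acts on the
generator by the displacement of the step. -/
theorem q_outArc {V : Type*} [AddCommGroup V] [Module Lambda V] [AddAction V D.MQ]
    (E : Displacement V D.MQ) {Ψ : D.AlexanderModule →ₗ[Lambda] V}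
    (hΨ : ∀ a, Ψ (D.arcClass a) = E.d (D.q a)) (c : Fin D.n) :
    D.q (D.outArc c) = Ψ (D.step c) +ᵥ D.q (D.inArc c) := by
  have h : D.q (D.b₂ c) = D.q (D.b₁ c) ▷ D.q (D.overArc c) :=
    Quotient.sound (s := exprSetoid D.CrossingRel) (ExprRel.of ⟨c⟩)
  rw [E.op_eq, ← hΨ, ← hΨ, ← map_sub] at h
  rcases Int.units_eq_one_or (D.writhe c) with hw | hw
  · simp only [b₁, b₂, if_pos hw] at h
    rw [step, hw, h, b₁, if_pos hw, Units.val_one, one_smul]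
  · have hw' : ¬ D.writhe c = 1 := by rw [hw]; decide
    simp only [b₁, b₂, if_neg hw'] at h
    rw [step, hw, h, b₁, if_neg hw', Units.val_neg, Units.val_one, neg_one_smul, map_neg,
      neg_vadd_vadd]

theorem vadd_q_of_mem {V : Type*} [AddCommGroup V] [Module Lambda V] [AddAction V D.MQ]
    (E : Displacement V D.MQ) {Ψ : D.AlexanderModule →ₗ[Lambda] V}
    (hΨ : ∀ a, Ψ (D.arcClass a) = E.d (D.q a)) (a : D.Arc) {x : D.kerPhi}
    (hx : x ∈ D.longitudeSubmodule (D.kappa a)) : Ψ x +ᵥ D.q a = D.q a := by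
  obtain ⟨r, rfl⟩ := Submodule.mem_span_singleton.mp hx
  have h := D.sum_vadd_eq_of_arc (fun c => Ψ (D.step c)) a D.q fun c _ => D.q_outArc E hΨ c
  rw [← map_sum, ← longitude_eq_sum_step] at h
  rw [Submodule.coe_smul, smul_longitude, map_zsmul]
  exact (AddAction.stabilizer V (D.q a)).zsmul_mem h _

section

variable [NeZero μ]

/-- The quandle `Q(ker φ^red, (ς(e_i)), (X_i))`, where `e_i` is an arc of component `i`. -/
noncomputable abbrev arcQuandleData (e : Fin μ → D.Arc)
    (hm : ∀ i, D.arcClass (e i) ∈ D.meridians i) : QuandleData (Fin μ) D.AlexanderModule :=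
  D.quandleData (fun i => D.arcClass (e i)) hm

/-- The isomorphism of `MQ(L)` with `Q(ker φ^red, (ς(e_i)), (X_i))`, where `e_i` is an arc of
component `i`, that is determined by walking along the components from the arcs `e_i`. -/
theorem exists_iso_of_primitive (e : Fin μ → D.Arc) (he : ∀ i, D.kappa (e i) = i)
    (hm : ∀ i, D.arcClass (e i) ∈ D.meridians i)
    (H : ∀ i, D.Arc → (D.arcQuandleData e hm).N ⧸ (D.arcQuandleData e hm).X i)
    (H0 : ∀ i, H i (e i) = 0)
    (Hs : ∀ i, ∀ c ∈ D.undercrossings i, H i (D.outArc c) = H i (D.inArc c) +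
      ((D.arcQuandleData e hm).X i).mkQ ⟨D.step c, D.phiRed_step c⟩) :
    ∃ f : MedialQuandleIso D.MQ (D.arcQuandleData e hm).Carrier,
      ∀ a, f.toFun (D.q a) = (D.arcQuandleData e hm).pt (D.kappa a) (H (D.kappa a) a) := by
  let Q := D.arcQuandleData e hm
  let st : Fin D.n → Q.N := fun c => ⟨D.step c, D.phiRed_step c⟩
  replace Hs : ∀ i, ∀ c ∈ D.undercrossings i, H i (D.outArc c) = H i (D.inArc c) +
    (Q.X i).mkQ (st c) := Hs
  have hsub : ∀ c, D.arcClass (D.overArc c) - D.arcClass (D.b₁ c) ∈ Q.N := fun c =>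
    LinearMap.mem_ker.mpr (by rw [map_sub, phiRed_arcClass, phiRed_arcClass, sub_self])
  -- Multiplication by `1 - t` turns the recursion for `H` into that of `arcClass_outArc`. Therefore
  -- `f(q_a)` will have displacement `ς(a) - ς(e_0)`, whichever component `a` lies on.
  have hA : ∀ i a, D.kappa a = i →
      (Q.oneSubT i (H i a) : D.AlexanderModule) = D.arcClass a - D.arcClass (e i) := by
    intro i a ha
    refine D.arc_induction (e := e i)
      (C := fun a => (Q.oneSubT i (H i a) : D.AlexanderModule) = D.arcClass a - D.arcClass (e i))
      ?_ (fun c hc h => ?_) (by rw [ha, he])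
    · rw [H0, map_zero, sub_self]
      rfl
    · rw [Hs i c (by rwa [he] at hc), map_add, D.arcClass_outArc, Submodule.coe_add, h]
      change _ + (1 - tVar) • D.step c = _
      abel
  -- The recursion in terms of `b₁` and `b₂` no longer involves the writhe.
  have hB : ∀ c i, D.comp (D.underPass c) = i → ∀ x : Q.N,
      (x : D.AlexanderModule) = D.arcClass (D.overArc c) - D.arcClass (D.b₁ c) →
      H i (D.b₂ c) = H i (D.b₁ c) + (Q.X i).mkQ x := by
    intro c i hi x hx
    have h := Hs i c (D.mem_undercrossings.mpr hi)
    rcases Int.units_eq_one_or (D.writhe c) with hw | hw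
    · have h1 : st c = x := by
        ext1
        rw [hx]
        simp [st, step, hw]
      rw [b₂, b₁, if_pos hw, if_pos hw, h, h1]
    · have h1 : st c = -x := by
        ext1
        rw [Submodule.coe_neg, hx]
        simp [st, step, hw]
      have hw' : ¬ D.writhe c = 1 := by rw [hw]; decide
      rw [b₂, b₁, if_neg hw', if_neg hw', h, h1, map_neg, neg_add_cancel_right]
  obtain ⟨f, hf, hfq⟩ := Presented.exists_lift (R := D.CrossingRel) (Q := Q.Carrier)
    (fun a => Q.pt (D.kappa a) (H (D.kappa a) a)) (by
      rintro _ _ ⟨c⟩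
      change Q.pt (D.kappa (D.b₂ c)) (H (D.kappa (D.b₂ c)) (D.b₂ c)) =
        Q.pt (D.kappa (D.b₁ c)) (H (D.kappa (D.b₁ c)) (D.b₁ c)) ▷
          Q.pt (D.kappa (D.overArc c)) (H (D.kappa (D.overArc c)) (D.overArc c))
      rw [D.kappa_b₂, D.kappa_b₁]
      have h1 := hA _ _ (D.kappa_b₁ c)
      have h2 := hA _ _ (rfl : D.kappa (D.overArc c) = _)
      obtain ⟨x, hx⟩ := (Q.X _).mkQ_surjective
        (H (D.comp (D.underPass c)) (D.b₁ c))
      obtain ⟨y, hy⟩ := (Q.X _).mkQ_surjective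
        (H (D.kappa (D.overArc c)) (D.overArc c))
      rw [hB c _ rfl ⟨D.arcClass (D.overArc c) - D.arcClass (D.b₁ c), hsub c⟩ rfl]
      rw [← hx] at h1 ⊢
      rw [← hy] at h2 ⊢
      rw [← map_add]
      refine Eq.trans ?_ (Q.pt_op_pt _ _ x y).symm
      refine congrArg (fun z => Q.pt _ ((Q.X _).mkQ z)) ?_
      ext1
      change (x : D.AlexanderModule) + (D.arcClass (D.overArc c) - D.arcClass (D.b₁ c)) =
        D.arcClass (e (D.kappa (D.overArc c))) - D.arcClass (e (D.comp (D.underPass c))) +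
          tVar • (x : D.AlexanderModule) + (1 - tVar) • (y : D.AlexanderModule)
      change (1 - tVar) • (x : D.AlexanderModule) = _ at h1
      change (1 - tVar) • (y : D.AlexanderModule) = _ at h2
      -- After `h2` is inserted, the difference of the two sides is exactly the relation `h1` for
      -- `b₁(c)`.
      rw [h2, ← sub_eq_zero]
      rw [← sub_eq_zero] at h1
      rw [← h1]
      module)
  obtain ⟨V, _, _, _, ⟨E⟩⟩ := exists_displacement (D.q (e 0))
  obtain ⟨Ψ, hΨ⟩ := D.exists_displacement_map E
  choose rep hrep using fun i => (Q.X i).mkQ_surjective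
  let g : Q.Carrier → D.MQ := fun x => Ψ (rep x.1 x.2) +ᵥ D.q (e x.1)
  -- The chosen representatives do not matter: two of them differ by an element of `X_i`, whose
  -- image under `Ψ` fixes `q_{e_i}`.
  have hg : ∀ i (x : Q.N), g (Q.pt i ((Q.X i).mkQ x)) =
      Ψ x +ᵥ D.q (e i) := by
    intro i x
    let y : Q.N := rep i ((Q.X i).mkQ x)
    have hy : (Q.X i).mkQ y = (Q.X i).mkQ x := hrep i _
    have h : y - x ∈ D.longitudeSubmodule (D.kappa (e i)) := by
      rw [he]
      exact (Submodule.Quotient.eq _).mp hy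
    have h2 := D.vadd_q_of_mem E hΨ (e i) h
    change Ψ y +ᵥ D.q (e i) = _
    conv_rhs => rw [← h2]
    rw [vadd_vadd, ← map_add, Submodule.coe_sub, add_sub_cancel]
  have hgop : ∀ x y, g (x ▷ y) = g x ▷ g y := by
    intro x y
    obtain ⟨i, x, rfl⟩ := Q.exists_pt x
    obtain ⟨j, y, rfl⟩ := Q.exists_pt y
    rw [Q.pt_op_pt]
    refine (hg _ _).trans ?_
    refine Eq.trans ?_ (congrArg₂ (· ▷ ·) (hg _ _) (hg _ _)).symm
    rw [E.op_eq, E.d_vadd, E.d_vadd, ← hΨ, ← hΨ, vadd_vadd]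
    congr 1
    change Ψ (D.arcClass (e j) - D.arcClass (e i) + tVar • (x : D.AlexanderModule) +
      (1 - tVar) • (y : D.AlexanderModule)) = _
    simp only [map_add, map_sub, map_smul]
    module
  have hgξ : ∀ i a, D.kappa a = i → g (Q.pt i (H i a)) = D.q a := by
    intro i a ha
    refine D.arc_induction (e := e i) (C := fun a => g (Q.pt i (H i a)) = D.q a)
      ?_ (fun c hc h => ?_) (by rw [ha, he])
    · rw [H0, ← map_zero (Q.X i).mkQ, hg, Submodule.coe_zero, map_zero, zero_vadd]
    · obtain ⟨x, hx⟩ := (Q.X i).mkQ_surjective (H i (D.inArc c))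
      rw [Hs i c (by rwa [he] at hc), ← hx, ← map_add, hg, D.q_outArc E hΨ, ← h, ← hx, hg,
        vadd_vadd, ← map_add]
      congr 2
      exact add_comm _ _
  have hgf : ∀ p, g (f p) = p := by
    intro p
    refine congrFun (Presented.hom_ext (f := g ∘ f) (g := id) (fun x y => ?_) (fun _ _ => rfl)
      fun a => ?_) p
    · simp only [Function.comp_apply, hf, hgop]
    · simp only [Function.comp_apply, hfq, id]
      exact hgξ _ a rfl
  -- The projection onto `ker φ^red` along `ς(e_0)`. It sends `ς(a)` to `ς(a) - ς(e_0)`, so these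
  -- differences generate the kernel.
  let pr : D.AlexanderModule →ₗ[Lambda] Q.N :=
    LinearMap.codRestrict Q.N (LinearMap.id - D.phiRed.smulRight (D.arcClass (e 0))) (by
      intro x
      change D.phiRed (x - D.phiRed x • D.arcClass (e 0)) = 0
      rw [map_sub, map_smul, phiRed_arcClass, smul_eq_mul, mul_one, sub_self])
  have hmatch : ∀ x : D.AlexanderModule, (Ψ (pr x), pr x) ∈
      matched E (Q.displacement 0) (D.q (e 0)) f hf := by
    intro x
    obtain ⟨x, rfl⟩ := (LinearMap.range D.rho).mkQ_surjective x
    let L : (D.Arc →₀ Lambda) →ₗ[Lambda] V × Q.N :=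
      ((Ψ ∘ₗ Q.N.subtype).prod LinearMap.id) ∘ₗ pr ∘ₗ D.sigma
    change L x ∈ _
    rw [← Finsupp.sum_single x, Finsupp.sum, map_sum]
    refine Submodule.sum_mem _ fun a _ => ?_
    rw [← Finsupp.smul_single_one, map_smul]
    refine Submodule.smul_mem _ _ ?_
    convert sub_mem_matched E (Q.displacement 0) (D.q (e 0)) f hf (D.q a) (D.q (e 0)) using 2
    · change Ψ (D.arcClass a - D.phiRed (D.arcClass a) • D.arcClass (e 0)) = _
      rw [phiRed_arcClass, one_smul, map_sub, hΨ, hΨ]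
    · ext1
      have h : ∀ b, ((Q.displacement 0).d (f (D.q b)) : D.AlexanderModule) =
          D.arcClass b - D.arcClass (e 0) := by
        intro b
        rw [hfq]
        change (D.arcClass (e (D.kappa b)) - D.arcClass (e 0)) +
          (Q.oneSubT (D.kappa b) (H _ b) : D.AlexanderModule) = _
        rw [hA _ _ rfl]
        abel
      change D.arcClass a - D.phiRed (D.arcClass a) • D.arcClass (e 0) = _
      rw [Submodule.coe_sub, h, h, phiRed_arcClass]
      module
  have hfg : ∀ x, f (g x) = x := by
    intro x
    obtain ⟨i, x, rfl⟩ := Q.exists_pt x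
    -- Moving `q_{e_i}` by `Ψ(x)` corresponds to moving its image, the zero of `Q_i`, by `x`.
    have h := mem_matched.mp (hmatch x) (D.q (e i))
    have hpr : pr x = x := by
      ext1
      change (x : D.AlexanderModule) - D.phiRed x • D.arcClass (e 0) = x
      rw [LinearMap.mem_ker.mp x.2, zero_smul, sub_zero]
    rw [hpr] at h
    refine (congrArg f (hg i x)).trans (h.trans ?_)
    rw [hfq, he, H0]
    refine (Q.vadd_pt _ _ _).trans ?_
    rw [add_zero]
  exact ⟨⟨⟨f, g, hgf, hfg⟩, hf⟩, hfq⟩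

end

end GaussDiagram

/-! ### Change of meridians -/

/-- A change of the elements `m_i` by elements of `(1 - t) N` does not change the quandle. -/
theorem QuandleData.nonempty_iso {I M : Type*} [Nonempty I] [AddCommGroup M] [Module Lambda M]
    (d d' : QuandleData I M) (hN : d'.N = d.N) (hX : HEq d'.X d.X) (n : I → d.N)
    (h : ∀ i, d.m i - d'.m i = (1 - tVar) • (n i : M)) :
    Nonempty (MedialQuandleIso d.Carrier d'.Carrier) := by
  obtain ⟨N, m, hm, X, hX1⟩ := d
  obtain ⟨N', m', hm', X', hX1'⟩ := d'
  obtain rfl : N' = N := hN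
  obtain rfl : X' = X := eq_of_heq hX
  let e : (QuandleData.mk N' m hm X' hX1).Carrier ≃ (QuandleData.mk N' m' hm' X' hX1').Carrier :=
    Equiv.sigmaCongrRight fun i => Equiv.addRight ((X' i).mkQ (n i))
  refine ⟨e, fun x y => ?_⟩
  obtain ⟨i, x, rfl⟩ := QuandleData.exists_pt _ x
  obtain ⟨j, y, rfl⟩ := QuandleData.exists_pt _ y
  refine congrArg (QuandleData.pt (QuandleData.mk N' m' hm' X' hX1') i)
    (congrArg (X' i).mkQ (?_ : _ + n i = _ + tVar • (x + n i) + (1 - tVar) • (y + n j)))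
  ext1
  change (m j - m i) + tVar • (x : M) + (1 - tVar) • (y : M) + (n i : M) =
    (m' j - m' i) + tVar • ((x : M) + n i) + (1 - tVar) • ((y : M) + n j)
  have h1 : m i - m' i = (1 - tVar) • (n i : M) := h i
  have h2 : m j - m' j = (1 - tVar) • (n j : M) := h j
  rw [sub_eq_iff_eq_add] at h1 h2
  rw [h1, h2]
  module

namespace GaussDiagram

open MedialQuandle

variable {μ : ℕ} (D : GaussDiagram μ)

theorem kappa_surjective (i : Fin μ) : ∃ a : D.Arc, D.kappa a = i := by
  by_cases h : ∃ p, D.comp p = i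
  · obtain ⟨p, hp⟩ := h
    exact ⟨D.arcAfter p, hp⟩
  · exact ⟨Quot.mk _ (.inr ⟨i, not_exists.mp h⟩), rfl⟩

section Meridians

variable [NeZero μ]

theorem exists_quandle_primitive (e : Fin μ → D.Arc) (he : ∀ i, D.kappa (e i) = i)
    (hm : ∀ i, D.arcClass (e i) ∈ D.meridians i) :
    ∃ H : ∀ i, D.Arc → (D.arcQuandleData e hm).N ⧸ (D.arcQuandleData e hm).X i,
      (∀ i, H i (e i) = 0) ∧ ∀ i, ∀ c ∈ D.undercrossings i, H i (D.outArc c) = H i (D.inArc c) +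
      ((D.arcQuandleData e hm).X i).mkQ ⟨D.step c, D.phiRed_step c⟩ := by
  have h : ∀ i, ∃ H : D.Arc → (D.arcQuandleData e hm).N ⧸ (D.arcQuandleData e hm).X i,
      H (e i) = 0 ∧ ∀ c ∈ D.undercrossings i, H (D.outArc c) = H (D.inArc c) +
      ((D.arcQuandleData e hm).X i).mkQ ⟨D.step c, D.phiRed_step c⟩ := by
    intro i
    have h := D.exists_arc_primitive (fun c =>
      ((D.arcQuandleData e hm).X i).mkQ ⟨D.step c, D.phiRed_step c⟩) (e i)
    rw [he] at h
    refine h ?_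
    rw [← map_sum]
    exact (Submodule.Quotient.mk_eq_zero _).mpr (D.sum_stepKer_mem i)
  choose H h1 h2 using h
  exact ⟨H, h1, h2⟩

/-- The identity map from the trivial module `ℤ` to the integers. -/
def TrivialInt.toInt : TrivialInt →+ ℤ := AddMonoidHom.id ℤ

theorem TrivialInt.toInt_smul (r : Lambda) (k : TrivialInt) :
    (r • k).toInt = augmentation r * k.toInt := rfl

/-- The kernel of `φ_τ` is `(1 - t) ker φ^red`. -/
theorem exists_eq_oneSubT_smul (x : D.AlexanderModule) (hx : D.phiTau x = 0) :
    ∃ n ∈ D.kerPhi, x = (1 - tVar) • n := by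
  choose e he using D.kappa_surjective
  let R : Submodule Lambda D.AlexanderModule :=
    D.kerPhi.map (LinearMap.lsmul Lambda D.AlexanderModule (1 - tVar))
  have hR : ∀ n, D.phiRed n = 0 → (1 - tVar) • n ∈ R := fun n hn =>
    Submodule.mem_map.mpr ⟨n, hn, rfl⟩
  let v : {i : Fin μ // i ≠ 0} → D.AlexanderModule := fun j =>
    D.arcClass (e j.1) - D.arcClass (e 0)
  have hv : ∀ j, D.phiRed (v j) = 0 := fun j => by
    rw [map_sub, phiRed_arcClass, phiRed_arcClass, sub_self]
  -- `T` depends on `x` only through `φ_τ(x)`, and modulo `R` it is a `Λ`-linear map that agrees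
  -- with the identity on arcs. Hence `x` is congruent to `T x`, which vanishes when `φ_τ(x) = 0`.
  let T : D.AlexanderModule → D.AlexanderModule := fun x =>
    (D.phiTau x).1 • D.arcClass (e 0) + ∑ j, ((D.phiTau x).2 j).toInt • v j
  have hTadd : ∀ x y, T (x + y) = T x + T y := by
    intro x y
    simp only [T, map_add, Prod.fst_add, Prod.snd_add, Pi.add_apply, add_smul,
      Finset.sum_add_distrib]
    abel
  have hTsmul : ∀ (r : Lambda) (x), r • T x - T (r • x) ∈ R := by
    intro r x
    have h : r • T x - T (r • x) = ∑ j, ((D.phiTau x).2 j).toInt •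
        (r • v j - augmentation r • v j) := by
      simp only [T, map_smul, Prod.smul_fst, Prod.smul_snd, Pi.smul_apply, smul_add,
        TrivialInt.toInt_smul, smul_eq_mul, Finset.smul_sum, smul_sub, Finset.sum_sub_distrib,
        mul_smul]
      rw [add_sub_add_left_eq_sub]
      congr 1
      · exact Finset.sum_congr rfl fun j _ => smul_comm _ _ _
      · exact Finset.sum_congr rfl fun j _ => smul_comm _ _ _
    rw [h]
    refine R.sum_mem fun j _ => zsmul_mem ?_ _
    -- `T` uses integer coefficients on the `v j`, so it is linear only up to replacing `r` by its
    -- augmentation; the error is a multiple of `1 - t`.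
    obtain ⟨s, hs⟩ := exists_smul_sub_augmentation r
    have h2 : r • v j - augmentation r • v j = (1 - tVar) • s • v j := by
      have h3 := congrArg (· • v j) hs
      beta_reduce at h3
      rw [h3, add_smul, Int.cast_smul_eq_zsmul, add_sub_cancel_left, mul_smul]
    rw [h2]
    exact hR _ (by rw [map_smul, hv, smul_zero])
  have harc : ∀ a, D.arcClass a - T (D.arcClass a) ∈ R := by
    intro a
    have h : T (D.arcClass a) = D.arcClass (e (D.kappa a)) := by
      have h1 : ∀ j : {i : Fin μ // i ≠ 0}, ((AMu.basePoint (D.kappa a)).2 j).toInt =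
          if D.kappa a = j.1 then 1 else 0 := by
        intro j
        change TrivialInt.toInt (if D.kappa a = j.1 then TrivialInt.one else 0) = _
        split_ifs <;> rfl
      simp only [T, phiTau_arcClass, h1]
      change (1 : Lambda) • D.arcClass (e 0) + _ = _
      rw [one_smul]
      by_cases h0 : D.kappa a = 0
      · rw [Finset.sum_eq_zero, add_zero, h0]
        intro j _
        rw [if_neg fun h2 => j.2 (h2.symm.trans h0), zero_smul]
      · rw [Finset.sum_eq_single ⟨D.kappa a, h0⟩]
        · rw [if_pos rfl, one_smul]
          exact add_sub_cancel _ _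
        · intro j _ hj
          rw [if_neg fun h2 => hj (Subtype.ext h2.symm), zero_smul]
        · simp
    rw [h]
    -- Arcs of one component are congruent modulo `R`, because each underpass changes the class by
    -- `1 - t` times a step.
    refine D.arc_induction (e := e (D.kappa a))
      (C := fun b => D.arcClass b - D.arcClass (e (D.kappa a)) ∈ R) ?_ (fun c _ hc => ?_)
      (he _).symm
    · rw [sub_self]
      exact R.zero_mem
    · rw [arcClass_outArc, add_sub_right_comm]
      exact R.add_mem hc (hR _ (D.phiRed_step c))
  have hall : ∀ x, x - T x ∈ R := by
    intro x
    obtain ⟨x, rfl⟩ := (LinearMap.range D.rho).mkQ_surjective x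
    induction x using Finsupp.induction_linear with
    | zero => simp [T]
    | add x y hx hy =>
      rw [map_add, hTadd, add_sub_add_comm]
      exact R.add_mem hx hy
    | single a r =>
      rw [← Finsupp.smul_single_one, map_smul]
      have h := R.add_mem (R.smul_mem r (harc a)) (hTsmul r (D.arcClass a))
      rwa [smul_sub, sub_add_sub_cancel] at h
  have h := hall x
  have hT : T x = 0 := by
    simp only [T, hx]
    simp
  rw [hT, sub_zero] at h
  obtain ⟨n, hn, h⟩ := Submodule.mem_map.mp h
  exact ⟨n, hn, h.symm⟩

theorem nonempty_iso_quandleData (m : Fin μ → D.AlexanderModule)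
    (hm : ∀ i, m i ∈ D.meridians i) :
    Nonempty (MedialQuandleIso (D.quandleData m hm).Carrier D.MQ) := by
  choose e he using D.kappa_surjective
  have hme : ∀ i, D.arcClass (e i) ∈ D.meridians i := fun i => ⟨e i, he i, rfl⟩
  obtain ⟨H, H0, Hs⟩ := D.exists_quandle_primitive e he hme
  obtain ⟨f, -⟩ := D.exists_iso_of_primitive e he hme H H0 Hs
  have h : ∀ i, ∃ n ∈ D.kerPhi, m i - D.arcClass (e i) = (1 - tVar) • n := by
    intro i
    refine D.exists_eq_oneSubT_smul _ ?_
    obtain ⟨a, ha, h⟩ := hm i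
    rw [map_sub, h, phiTau_arcClass, phiTau_arcClass, ha, he, sub_self]
  choose n hn h using h
  obtain ⟨g⟩ := (D.quandleData m hm).nonempty_iso (D.arcQuandleData e hme) rfl HEq.rfl
    (fun i => ⟨n i, hn i⟩) h
  refine ⟨g.toEquiv.trans f.toEquiv.symm, fun x y => ?_⟩
  refine f.toEquiv.symm_apply_eq.mpr ?_
  refine (g.map_op x y).trans (Eq.trans ?_ (f.map_op _ _).symm)
  exact congrArg₂ (· ▷ ·) (f.toEquiv.apply_symm_apply _).symm (f.toEquiv.apply_symm_apply _).symm

end Meridians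

/-! ### Diagrams with alternating writhes -/

/-- The arc ends at the underpass of `c`. -/
def EndsAt (c : Fin D.n) : D.Arc → Prop :=
  Quot.lift (Sum.elim (fun p => ∃ k, D.next^[k + 1] p = D.underPass c ∧
    ∀ j < k, (D.next^[j + 1] p).2 = true) fun _ => False) (by
    rintro _ _ ⟨c'⟩
    simp only [Sum.elim_inl, eq_iff_iff]
    constructor
    · rintro ⟨_ | k, h1, h2⟩
      · rw [Function.iterate_one, Equiv.apply_symm_apply] at h1
        exact absurd (congrArg Prod.snd h1) (by simp)
      · refine ⟨k, ?_, fun j hj => ?_⟩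
        · rwa [Function.iterate_succ_apply, Equiv.apply_symm_apply] at h1
        · have h := h2 (j + 1) (by omega)
          rwa [Function.iterate_succ_apply, Equiv.apply_symm_apply] at h
    · rintro ⟨k, h1, h2⟩
      refine ⟨k + 1, ?_, fun j hj => ?_⟩
      · rwa [Function.iterate_succ_apply, Equiv.apply_symm_apply]
      · rw [Function.iterate_succ_apply, Equiv.apply_symm_apply]
        rcases j with _ | j
        · rfl
        · exact h2 j (by omega))

/-- Arcs are classes of pieces, so separating them requires an invariant: `EndsAt` is compatible
with joining pieces at overpasses and detects the crossing where an arc ends. -/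
theorem inArc_injective : Function.Injective D.inArc := by
  intro c c' h
  have h1 : D.EndsAt c (D.inArc c) := ⟨0, by simp, by simp⟩
  rw [h] at h1
  obtain ⟨_ | k, h1, h2⟩ := h1
  · rw [Function.iterate_one, Equiv.apply_symm_apply] at h1
    exact (congrArg Prod.fst h1).symm
  · have h3 := h2 0 (Nat.succ_pos k)
    rw [Function.iterate_one, Equiv.apply_symm_apply] at h3
    exact absurd h3 (by simp)

/-- By counting: if no underpass emitted this arc, then `sum_inArc` for its indicator function would
equate a positive number with `0`. -/
theorem exists_outArc_eq_inArc (c : Fin D.n) : ∃ c', D.outArc c' = D.inArc c := by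
  classical
  by_contra! h
  have h1 := D.sum_inArc (D.comp (D.underPass c)) fun a => if a = D.inArc c then (1 : ℤ) else 0
  simp only [h, if_false, Finset.sum_const_zero] at h1
  have h2 := (Finset.sum_eq_zero_iff_of_nonneg fun x _ => by split_ifs <;> simp).mp h1 c
    (D.mem_undercrossings.mpr rfl)
  simp at h2

/-- `nextUnder` is surjective on a finite set, hence injective, and the arc leaving `c` determines
the next underpass. -/
theorem outArc_injective : Function.Injective D.outArc := by
  have hsurj : Function.Surjective D.nextUnder := fun c => by
    obtain ⟨c', h⟩ := D.exists_outArc_eq_inArc c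
    exact ⟨c', D.inArc_injective ((D.inArc_nextUnder c').trans h)⟩
  intro c c' h
  apply Finite.injective_iff_surjective.mpr hsurj
  apply D.inArc_injective
  rw [inArc_nextUnder, inArc_nextUnder, h]

theorem underArc_iff (c : Fin D.n) (a : D.Arc) :
    (D.b₁ c = a ∨ D.b₂ c = a) ↔ (D.inArc c = a ∨ D.outArc c = a) := by
  unfold b₁ b₂
  split_ifs
  · rfl
  · exact or_comm

theorem AlternatingWrithes.existsUnique {D : GaussDiagram μ} (hD : D.AlternatingWrithes)
    (w : ℤˣ) (a : D.Arc) : ∃! c, D.writhe c = w ∧ (D.inArc c = a ∨ D.outArc c = a) := by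
  simp only [← underArc_iff]
  rcases Int.units_eq_one_or w with rfl | rfl
  · exact (hD a).1
  · exact (hD a).2

/-- If the two ends of an arc had equal writhes, uniqueness would make them the same crossing `c`.
The crossing of opposite writhe at this arc would then also be `c`, which is absurd. -/
theorem AlternatingWrithes.writhe_nextUnder {D : GaussDiagram μ} (hD : D.AlternatingWrithes)
    (c : Fin D.n) : D.writhe (D.nextUnder c) = -D.writhe c := by
  by_contra h
  have hw : D.writhe (D.nextUnder c) = D.writhe c := by
    rcases Int.units_eq_one_or (D.writhe c) with h1 | h1 <;>
    rcases Int.units_eq_one_or (D.writhe (D.nextUnder c)) with h2 | h2 <;>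
    simp_all
  have h1 : D.nextUnder c = c := (hD.existsUnique (D.writhe c) (D.outArc c)).unique
    ⟨hw, .inl (D.inArc_nextUnder c)⟩ ⟨rfl, .inr rfl⟩
  obtain ⟨c', ⟨hw', h2⟩, -⟩ := hD.existsUnique (-D.writhe c) (D.outArc c)
  have h3 : c' = c := by
    rcases h2 with h2 | h2
    · rw [← D.inArc_nextUnder, h1] at h2
      exact D.inArc_injective h2
    · exact D.outArc_injective h2
  rw [h3] at hw'
  exact units_ne_neg_self _ hw'

theorem AlternatingWrithes.exists_isBase {D : GaussDiagram μ} (hD : D.AlternatingWrithes) :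
    ∃ s, D.IsBase s := by
  have h : ∀ i, ∃ c, D.kappa (D.outArc c) = i ∧ D.writhe c = 1 ∧
      D.writhe (D.nextUnder c) = -1 := by
    intro i
    obtain ⟨a, rfl⟩ := D.kappa_surjective i
    obtain ⟨c, ⟨hw, h⟩, -⟩ := hD.existsUnique 1 a
    refine ⟨c, ?_, hw, by rw [hD.writhe_nextUnder, hw]⟩
    rcases h with rfl | rfl
    · rw [kappa_outArc, kappa_inArc]
    · rfl
  choose s hs using h
  exact ⟨s, hs⟩

/-! ### The walk from a base arc and the formulas for `ξ` -/

section Walk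

variable {D} {s : Fin μ → Fin D.n}

theorem inArc_walkCrossing (i : Fin μ) (j : ℕ) :
    D.inArc (D.walkCrossing s i j) = D.walkArc s i j := by
  rw [walkCrossing, Function.iterate_succ_apply', inArc_nextUnder]
  rfl

theorem outArc_walkCrossing (i : Fin μ) (j : ℕ) :
    D.outArc (D.walkCrossing s i j) = D.walkArc s i (j + 1) := rfl

theorem IsBase.kappa_walkArc (hs : D.IsBase s) (i : Fin μ) (j : ℕ) :
    D.kappa (D.walkArc s i j) = i := by
  induction j with
  | zero => exact (hs i).1
  | succ j ih =>
    rw [← outArc_walkCrossing, kappa_outArc, ← kappa_inArc, inArc_walkCrossing, ih]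

theorem IsBase.walkCrossing_mem (hs : D.IsBase s) (i : Fin μ) (j : ℕ) :
    D.walkCrossing s i j ∈ D.undercrossings i := by
  rw [mem_undercrossings, ← kappa_inArc, inArc_walkCrossing, hs.kappa_walkArc]

theorem IsBase.walkArc_walkIndex (hs : D.IsBase s) (a : D.Arc) :
    D.walkArc s (D.kappa a) (D.walkIndex s a) = a := by
  have h : ∃ j, D.walkArc s (D.kappa a) j = a := by
    refine D.arc_induction (e := D.walkArc s (D.kappa a) 0)
      (C := fun b => ∃ j, D.walkArc s (D.kappa a) j = b) ⟨0, rfl⟩ ?_ (hs.kappa_walkArc _ _).symm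
    rintro c - ⟨j, hj⟩
    refine ⟨j + 1, ?_⟩
    rw [← inArc_walkCrossing] at hj
    rw [← outArc_walkCrossing, D.inArc_injective hj]
  exact Nat.sInf_mem h

theorem IsBase.writhe_walkCrossing (hs : D.IsBase s) (hD : D.AlternatingWrithes) (i : Fin μ)
    (j : ℕ) : D.writhe (D.walkCrossing s i j) = (-1) ^ (j + 1) := by
  induction j with
  | zero =>
    rw [zero_add, pow_one]
    exact (hs i).2.2
  | succ j ih =>
    rw [walkCrossing, Function.iterate_succ_apply', hD.writhe_nextUnder]
    change -D.writhe (D.walkCrossing s i j) = _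
    rw [ih, pow_succ _ (j + 1), mul_neg_one]

/-- The two formulas for `ξ_i` are linked by `t ξ_i(b_{ij}) = ς(b_{i0}) + ∑` for odd `j`, where `∑`
is the alternating sum. For even `j` the crossing has writhe `-1` and its relation supplies the
factor `t⁻¹`; for odd `j` the writhe is `1` and the hypothesis on `ς(b_{ij})` removes this factor.
-/
theorem xiValue_succ (hs : D.IsBase s) (hD : D.AlternatingWrithes) (i : Fin μ) (j : ℕ)
    (h : D.arcClass (D.walkArc s i j) =
      D.arcClass (D.walkArc s i 0) + (1 - tVar) • D.xiValue s i j) :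
    D.xiValue s i (j + 1) = D.xiValue s i j + D.step (D.walkCrossing s i j) := by
  have hw := hs.writhe_walkCrossing hD i j
  have hW : D.walkSum s i (j + 1) = D.walkSum s i j +
      (-1 : ℤ) ^ (j + 1) • D.arcClass (D.overArc (D.walkCrossing s i j)) :=
    Finset.sum_range_succ _ _
  rw [step, hw, xiValue, hW]
  rcases Nat.even_or_odd j with hj | hj
  · rw [hj.add_one.neg_one_pow] at hw ⊢
    rw [hj.add_one.neg_one_pow]
    have hr := D.crossing_relation (D.walkCrossing s i j)
    have hw1 : ¬ D.writhe (D.walkCrossing s i j) = 1 := by rw [hw]; decide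
    rw [b₂, if_neg hw1, inArc_walkCrossing, h, xiValue, if_pos hj] at hr
    rw [xiValue, if_pos hj, if_neg (Nat.not_even_iff_odd.mpr hj.add_one), ← smul_add]
    set W := D.walkSum s i j
    set a := D.arcClass (D.overArc (D.walkCrossing s i j))
    set b := D.arcClass (D.b₁ (D.walkCrossing s i j))
    have hb : D.arcClass (D.walkArc s i 0) + (W + (-1 : ℤ) • a) =
        tVar • (W + (-1 : ℤ) • (a - b)) := by
      rw [eq_sub_of_add_eq hr]
      module
    rw [hb, tInv_smul_tVar_smul]
    rfl
  · rw [hj.add_one.neg_one_pow] at hw ⊢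
    rw [hj.add_one.neg_one_pow]
    rw [b₁, if_pos hw, inArc_walkCrossing, if_pos hj.add_one, h]
    have hx : tVar • D.xiValue s i j = D.arcClass (D.walkArc s i 0) + D.walkSum s i j := by
      rw [xiValue, if_neg (Nat.not_even_iff_odd.mpr hj), ← smul_add, tVar_smul_tInv_smul]
    have hx2 := eq_sub_of_add_eq' hx.symm
    rw [hx2, Units.val_one]
    module

theorem arcClass_walkArc (hs : D.IsBase s) (hD : D.AlternatingWrithes) (i : Fin μ) (j : ℕ) :
    D.arcClass (D.walkArc s i j) =
      D.arcClass (D.walkArc s i 0) + (1 - tVar) • D.xiValue s i j := by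
  induction j with
  | zero => simp [xiValue, walkSum]
  | succ j ih =>
    rw [xiValue_succ hs hD i j ih, ← outArc_walkCrossing, arcClass_outArc, inArc_walkCrossing, ih,
      smul_add, add_assoc]

theorem exists_iso_xi [NeZero μ] (hs : D.IsBase s) (hD : D.AlternatingWrithes) :
    ∃ f : MedialQuandleIso D.MQ (D.baseQuandleData hs).Carrier,
      ∀ a : D.Arc, f.toFun (D.q a) = D.xi hs a := by
  have he : ∀ i, D.kappa (D.walkArc s i 0) = i := fun i => (hs i).1
  have hm := D.walkArc_mem_meridians hs
  obtain ⟨H, H0, Hs⟩ := D.exists_quandle_primitive (fun i => D.walkArc s i 0) he hm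
  obtain ⟨f, hf⟩ := D.exists_iso_of_primitive (fun i => D.walkArc s i 0) he hm H H0 Hs
  -- This holds for every `j`, also beyond one turn around the component. Since `H i` is a function
  -- of the arc, the value of `ξ` modulo `X_i` does not depend on the index chosen by `walkIndex`.
  have hH : ∀ i j, H i (D.walkArc s i j) =
      ((D.arcQuandleData (fun i => D.walkArc s i 0) hm).X i).mkQ
        ⟨D.xiValue s i j, D.xiValue_mem s i j⟩ := by
    intro i j
    induction j with
    | zero =>
      rw [H0]
      refine (map_zero _).symm.trans (congrArg _ (Subtype.ext ?_))
      simp [xiValue, walkSum]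
    | succ j ih =>
      rw [← outArc_walkCrossing, Hs i _ (hs.walkCrossing_mem i j), inArc_walkCrossing, ih,
        ← map_add]
      exact congrArg _ (Subtype.ext
        (xiValue_succ hs hD i j (arcClass_walkArc hs hD i j)).symm)
  refine ⟨f, fun a => (hf a).trans ?_⟩
  have h := hH (D.kappa a) (D.walkIndex s a)
  rw [hs.walkArc_walkIndex] at h
  rw [h]
  rfl

end Walk

end GaussDiagram

theorem mainTheorem1 {μ : ℕ} [NeZero μ] (D : GaussDiagram μ) :
    (∀ (m : Fin μ → D.AlexanderModule) (hm : ∀ i, m i ∈ D.meridians i),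
      Nonempty (MedialQuandleIso (D.quandleData m hm).Carrier D.MQ)) ∧
    (D.AlternatingWrithes →
      (∃ s : Fin μ → Fin D.n, D.IsBase s) ∧
      ∀ (s : Fin μ → Fin D.n) (hs : D.IsBase s),
        ∃ f : MedialQuandleIso D.MQ (D.baseQuandleData hs).Carrier,
          ∀ a : D.Arc, f.toFun (D.q a) = D.xi hs a) :=
  ⟨D.nonempty_iso_quandleData, fun hD =>
    ⟨hD.exists_isBase, fun _ hs => GaussDiagram.exists_iso_xi hs hD⟩⟩
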